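/- **Setting.** Let $T>0$ and let $W^{1,s}=W^{1,s}([0,T];\mathbb R^n)$ be the space of absolutely continuous $x:[0,T]\to\mathbb R^n$ with $\dot x\in L^s$, normed by $\|x\|_{1,s}=\|x\|_s+\|\dot x\|_s$. Put $X=W^{1,\infty}\times L^\infty([0,T];\mathbb R^m)$ and $Y=W^{1,1}\times L^1([0,T];\mathbb R^m)$. Let $X_0\subseteq X$ be a convex set that is closed in $X$ with respect to the topology of $Y$. Consider the problem $(\mathcal P)$ of minimising $J(x,u)=\int_0^T F_0(x(t),u(t),t)\,dt+f_0(x(0),x(T))$ over $(x,u)\in X_0$ subject to $$\dot x(t)=F(x(t),u(t),t)\ \text{a.e.},\quad f_i(x(0),x(T))\le 0\ (i\in\mathcal I),\quad f_j(x(0),x(T))=0\ (j\in\mathcal E),\quad \Xi_s(x(t),u(t),t)\le 0\ \text{a.e.}\ (s\in\mathcal M),$$ with finite (possibly empty) index sets $\mathcal I,\mathcal E,\mathcal M$. Here $F_0=G_0-H_0$, $F=G-H$ (values in $\mathbb R^n$), $\Xi_s=p_s-q_s$, $f_i=g_i-h_i$, where $G_0,H_0,p_s,q_s$ and the coordinates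 $G_l,H_l$ of $G,H$ are real-valued and convex in $(x,u)$, and $g_i,h_i$ are real-valued and convex. The functions $G_0,H_0,G,H,p_s,q_s$ are Carathéodory functions (continuous in $(x,u)$ for a.e. $t$, measurable in $t$), and for every $R>0$ there is $\gamma_R>0$ such that for a.e. $t$ and all $(x,u)$ with $|x|+|u|\le R$ the absolute values of these functions, and the norms of all their (coordinatewise) convex subgradients in $(x,u)$, are at most $\gamma_R$ at $(x,u,t)$. For every $(x,u)\in X$ the set-valued maps $t\mapsto\partial_{x,u}\psi(x(t),u(t),t)$, with $\psi$ any of $G_0,H_0,G_l,H_l,p_s,q_s$, are measurable. The penalty term is $$\varphi(x,u)=\sum_{i=1}^n\int_0^T|\dot x_i-F_i(x,u,t)|\,dt+\sum_{i\in\mathcal I}\max\{0,f_i(x(0),x(T))\}+\sum_{j\in\mathcal E}|f_j(x(0),x(T))|+\sum_{s\in\mathcal M}\int_0^T\max\{0,\Xi_s(x,u,t)\}\,dt,$$ and $\Phi_c=J+c\varphi$. **The method (B-STEP-DCA).** Write $z=(x,u)$, $b=(x(0),x(T))$, $a=(x,u)\in X$, $a_k=(x_k,u_k)$, and $z_k,b_k$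 for the corresponding objects of $a_k$. A collection $V_k$ of subgradients at $a_k$ consists of measurable $V_{kl}(t)\in\partial H_l(z_k(t),t)$ ($0\le l\le n$), $W_{kl}(t)\in\partial G_l(z_k(t),t)$ ($1\le l\le n$), $z_{ks}(t)\in\partial q_s(z_k(t),t)$ for a.e. $t$, and of vectors $v_{ki}\in\partial h_i(b_k)$ ($i\in\{0\}\cup\mathcal I\cup\mathcal E$), $w_{kj}\in\partial g_j(b_k)$ ($j\in\mathcal E$). Put $$\begin{aligned}\Gamma_k(a)={}&\sum_{i=1}^n\int_0^T\max\{\dot x_i+H_i(z,t)-G_i(z_k,t)-\langle W_{ki},z-z_k\rangle,\,-\dot x_i+G_i(z,t)-H_i(z_k,t)-\langle V_{ki},z-z_k\rangle\}\,dt\\&+\sum_{i\in\mathcal I}\max\{0,g_i(b)-h_i(b_k)-\langle v_{ki},b-b_k\rangle\}\\&+\sum_{j\in\mathcal E}\max\{g_j(b)-h_j(b_k)-\langle v_{kj},b-b_k\rangle,\,h_j(b)-g_j(b_k)-\langle w_{kj},b-b_k\rangle\}\\&+\sum_{s\in\mathcal M}\int_0^T\max\{0,p_s(z,t)-q_s(z_k,t)-\langle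 z_{ks},z-z_k\rangle\}\,dt,\end{aligned}$$ $$Q_{c,k}(a)=\int_0^T\big(G_0(z,t)-\langle V_{k0},z\rangle\big)\,dt+g_0(b)-\langle v_{k0},b\rangle+c\,\Gamma_k(a).$$ Fix $\eta_1,\eta_2,\zeta,\sigma\in(0,1)$, $\varepsilon_\varphi,\varepsilon_{feas}>0$, $\varepsilon_k>0$, $c_0>0$ and $a_0\in X_0$. Below, "a solution for $c$" means an $\varepsilon_k$-optimal solution of $\min_{X_0}Q_{c,k}$. An infinite sequence $\{a_k\}$ is *generated by the method* if for every $k$ there is such a $V_k$ with which $a_{k+1}$ and $c_{k+1}$ arise from $a_k$ and $c_k$ as follows. 1. Put $c_+=c_k$ and take a solution $a_+$ for $c_+$. If $\Gamma_k(a_+)\le\varepsilon_\varphi$, go to 4; otherwise go to 2. 2. Take an $\varepsilon_k$-optimal solution $\hat a$ of $\min_{X_0}\Gamma_k$. If $\Gamma_k(\hat a)<\Gamma_k(a_k)$, go to 3. Otherwise, while $\Gamma_k(a_+)\le\Gamma_k(a_k)+\varepsilon_{feas}$ fails, increase $c_+$ and take a new solution $a_+$ for $c_+$; then go to 4. 3.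 While $\Gamma_k(a_+)-\Gamma_k(a_k)\le\eta_1(\Gamma_k(\hat a)-\Gamma_k(a_k))$ fails, increase $c_+$ and take a new solution $a_+$ for $c_+$; then go to 4. 4. Put $c_{k+1}=c_+$ and $a'=a_+$. While $Q_{c_{k+1},k}(a')-Q_{c_{k+1},k}(a_k)\le c_{k+1}\eta_2(\Gamma_k(a')-\Gamma_k(a_k))$ fails, increase $c_{k+1}$ and take a new solution $a'$ for $c_{k+1}$. 5. Choose $\nu_k>0$ and $\bar\alpha_k\ge0$ such that $a'+\zeta^j\bar\alpha_k(a'-a_k)\in X_0$ for all $j\ge 0$. With the least $j\ge 0$ for which $$\Phi_{c_{k+1}}\big(a'+\zeta^j\bar\alpha_k(a'-a_k)\big)-\Phi_{c_{k+1}}(a')\le-\sigma(\zeta^j\bar\alpha_k)^2\|a'-a_k\|_{L^2}^2+\nu_k,$$ put $a_{k+1}=a'+\zeta^j\bar\alpha_k(a'-a_k)$. **Theorem.** Let $\{(x_k,u_k)\}$ be generated by the method, let $\{x_k\}$ be bounded in $W^{1,r}$ for some $1<r\le\infty$, and let $\varphi(x_k,u_k)\to0$ as $k\to\infty$. Suppose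 that a subsequence $\{u_{k_l}\}$ is bounded in $L^\infty$ and converges in $L^1$ to some $u_*\in L^\infty([0,T];\mathbb R^m)$. Then $\{x_{k_l}\}$ is relatively compact in $W^{1,1}$, and each of its limit points $x_*$ in $W^{1,1}$ belongs to $W^{1,\infty}$ and is such that $(x_*,u_*)$ is feasible for $(\mathcal P)$. If, in addition, the initial condition is fixed, i.e. there is $x^0\in\mathbb R^n$ with $x(0)=x^0$ for every feasible pair $(x,u)$ of $(\mathcal P)$ (for instance, if $X_0\subseteq\{(x,u)\in X: x(0)=x^0\}$), then $\{x_{k_l}\}$ converges in $W^{1,1}$. -/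

import Mathlib

open MeasureTheory Set Filter Topology
open scoped ENNReal InnerProductSpace

noncomputable section

namespace StepDCA

/-- `ℝⁿ` with the Euclidean norm. -/
abbrev Euc (n : ℕ) := EuclideanSpace ℝ (Fin n)

/-- Lebesgue measure on `[0, T]`. -/
abbrev mu (T : ℝ) : Measure ℝ := volume.restrict (Icc 0 T)

/-! ### The Sobolev spaces `W^{1,s}([0,T]; ℝⁿ)` -/

/-- The extension by zero to `ℝ` of a function on `[0, T]`. -/
def ext0 {T : ℝ} {n : ℕ} (x : Icc (0 : ℝ) T → Euc n) : ℝ → Euc n :=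
  Function.extend Subtype.val x 0

theorem ext0_apply {T : ℝ} {n : ℕ} (x : Icc (0 : ℝ) T → Euc n) (t : Icc (0 : ℝ) T) :
    ext0 x t = x t := Subtype.val_injective.extend_apply x 0 t

theorem ext0_add {T : ℝ} {n : ℕ} (x y : Icc (0 : ℝ) T → Euc n) :
    ext0 (x + y) = ext0 x + ext0 y := by
  funext t
  by_cases h : t ∈ Icc (0 : ℝ) T
  · simp [ext0,
      Subtype.val_injective.extend_apply _ _ (⟨t, h⟩ : Icc (0 : ℝ) T)]
  · have : ¬ ∃ a : Icc (0 : ℝ) T, a.val = t := fun ⟨a, ha⟩ => h (ha ▸ a.2)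
    simp [ext0, Function.extend_apply' _ _ _ this]

theorem ext0_smul {T : ℝ} {n : ℕ} (c : ℝ) (x : Icc (0 : ℝ) T → Euc n) :
    ext0 (c • x) = c • ext0 x := by
  funext t
  by_cases h : t ∈ Icc (0 : ℝ) T
  · have h1 := ext0_apply (c • x) (⟨t, h⟩ : Icc (0 : ℝ) T)
    have h2 := ext0_apply x (⟨t, h⟩ : Icc (0 : ℝ) T)
    simp only at h1 h2
    simp [h1, h2]
  · have : ¬ ∃ a : Icc (0 : ℝ) T, a.val = t := fun ⟨a, ha⟩ => h (ha ▸ a.2)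
    simp [ext0, Function.extend_apply' _ _ _ this]

theorem ae_differentiable {T : ℝ} {n : ℕ} {f : ℝ → Euc n}
    (hf : AbsolutelyContinuousOnInterval f 0 T) : ∀ᵐ t ∂(mu T), DifferentiableAt ℝ f t := by
  rw [ae_restrict_iff' measurableSet_Icc]
  by_cases hT : 0 ≤ T
  · filter_upwards [hf.boundedVariationOn.ae_differentiableAt_of_mem_uIcc] with t ht h
    exact ht (by rwa [uIcc_of_le hT])
  · simp [Icc_eq_empty hT]

theorem ae_deriv_add {T : ℝ} {n : ℕ} {f g : ℝ → Euc n}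
    (hf : AbsolutelyContinuousOnInterval f 0 T) (hg : AbsolutelyContinuousOnInterval g 0 T) :
    deriv (f + g) =ᵐ[mu T] deriv f + deriv g := by
  filter_upwards [ae_differentiable hf, ae_differentiable hg] with t h1 h2
  exact deriv_add h1 h2

theorem ae_deriv_smul {T : ℝ} {n : ℕ} {f : ℝ → Euc n} (c : ℝ)
    (hf : AbsolutelyContinuousOnInterval f 0 T) :
    deriv (c • f) =ᵐ[mu T] c • deriv f := by
  filter_upwards [ae_differentiable hf] with t h1
  exact deriv_const_smul c h1

/-- The absolutely continuous functions on `[0, T]` with derivative in `L^s`. (Up to a null set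
the derivative of `ext0 x` on `[0, T]` does not depend on how `x` is extended.) -/
def w1Submodule (T : ℝ) (n : ℕ) (s : ℝ≥0∞) : Submodule ℝ (Icc (0 : ℝ) T → Euc n) where
  carrier := {x | AbsolutelyContinuousOnInterval (ext0 x) 0 T ∧ MemLp (deriv (ext0 x)) s (mu T)}
  zero_mem' := by
    have h : ext0 (0 : Icc (0 : ℝ) T → Euc n) = 0 := by
      simpa using ext0_smul (0 : ℝ) (0 : Icc (0 : ℝ) T → Euc n)
    refine ⟨?_, ?_⟩
    · rw [h]; simpa [AbsolutelyContinuousOnInterval] using tendsto_const_nhds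
    · rw [h]; simp
  add_mem' := by
    rintro x y ⟨hx, hx'⟩ ⟨hy, hy'⟩
    refine ⟨by rw [ext0_add]; exact hx.add hy, ?_⟩
    rw [ext0_add]
    exact (hx'.add hy').ae_eq (ae_deriv_add hx hy).symm
  smul_mem' := by
    rintro c x ⟨hx, hx'⟩
    refine ⟨by rw [ext0_smul]; exact hx.const_smul c, ?_⟩
    rw [ext0_smul]
    exact (hx'.const_smul c).ae_eq (ae_deriv_smul c hx).symm

/-- The space `W^{1,s}([0,T]; ℝⁿ)`. -/
def W1 (T : ℝ) (n : ℕ) (s : ℝ≥0∞) : Type := ↥(w1Submodule T n s)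

instance (T : ℝ) (n : ℕ) (s : ℝ≥0∞) : AddCommGroup (W1 T n s) :=
  inferInstanceAs (AddCommGroup ↥(w1Submodule T n s))

instance (T : ℝ) (n : ℕ) (s : ℝ≥0∞) : Module ℝ (W1 T n s) :=
  inferInstanceAs (Module ℝ ↥(w1Submodule T n s))

/-- The value `x(t)`, for `t ∈ [0, T]`. -/
def W1.val {T : ℝ} {n : ℕ} {s : ℝ≥0∞} (x : W1 T n s) : ℝ → Euc n := ext0 x.1

/-- The derivative `ẋ(t)`. -/
def W1.dot {T : ℝ} {n : ℕ} {s : ℝ≥0∞} (x : W1 T n s) : ℝ → Euc n := deriv x.val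

theorem W1.memLp_val {T : ℝ} {n : ℕ} {s : ℝ≥0∞} (x : W1 T n s) : MemLp x.val s (mu T) := by
  have hx : AbsolutelyContinuousOnInterval x.val 0 T := x.2.1
  by_cases hT : 0 ≤ T
  · obtain ⟨C, hC⟩ := hx.exists_bound
    have hc := hx.continuousOn
    rw [uIcc_of_le hT] at hC hc
    refine MemLp.of_bound (hc.aestronglyMeasurable measurableSet_Icc) C ?_
    filter_upwards [ae_restrict_mem measurableSet_Icc] with t ht using hC t ht
  · simp [mu, Icc_eq_empty hT]

theorem W1.memLp_dot {T : ℝ} {n : ℕ} {s : ℝ≥0∞} (x : W1 T n s) : MemLp x.dot s (mu T) := x.2.2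

/-- The pair `(x, ẋ)` as an element of `L^s × L^s` with the sum of the two norms. -/
def W1.toPair (T : ℝ) (n : ℕ) (s : ℝ≥0∞) :
    W1 T n s →ₗ[ℝ] WithLp 1 (Lp (Euc n) s (mu T) × Lp (Euc n) s (mu T)) where
  toFun x := WithLp.toLp 1 (x.memLp_val.toLp x.val, x.memLp_dot.toLp x.dot)
  map_add' x y := by
    have h1 : (x + y).val = x.val + y.val := ext0_add x.1 y.1
    have h2 : (x + y).dot =ᵐ[mu T] x.dot + y.dot := by
      rw [W1.dot, h1]; exact ae_deriv_add x.2.1 y.2.1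
    rw [← WithLp.toLp_add, Prod.mk_add_mk, ← MemLp.toLp_add, ← MemLp.toLp_add]
    congr 2
    · exact (MemLp.toLp_eq_toLp_iff _ _).2 (by rw [h1])
    · exact (MemLp.toLp_eq_toLp_iff _ _).2 h2
  map_smul' c x := by
    have h1 : (c • x).val = c • x.val := ext0_smul c x.1
    have h2 : (c • x).dot =ᵐ[mu T] c • x.dot := by
      rw [W1.dot, h1]; exact ae_deriv_smul c x.2.1
    rw [RingHom.id_apply, ← WithLp.toLp_smul, Prod.smul_mk, ← MemLp.toLp_const_smul,
      ← MemLp.toLp_const_smul]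
    congr 2
    · exact (MemLp.toLp_eq_toLp_iff _ _).2 (by rw [h1])
    · exact (MemLp.toLp_eq_toLp_iff _ _).2 h2

theorem W1.toPair_injective (T : ℝ) [hT : Fact (0 < T)] (n : ℕ) (s : ℝ≥0∞) :
    Function.Injective (W1.toPair T n s) := by
  intro x y h
  have h1 : x.memLp_val.toLp x.val = y.memLp_val.toLp y.val :=
    congrArg (fun z => (WithLp.ofLp z).1) h
  rw [MemLp.toLp_eq_toLp_iff] at h1
  have hx := x.2.1.continuousOn
  have hy := y.2.1.continuousOn
  rw [uIcc_of_le hT.out.le] at hx hy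
  have h2 : EqOn x.val y.val (Icc 0 T) :=
    Measure.eqOn_Icc_of_ae_eq volume hT.out.ne h1 hx hy
  apply Subtype.ext
  funext t
  rw [← ext0_apply x.1 t, ← ext0_apply y.1 t]
  exact h2 t.2

/-- The norm `‖x‖_{1,s} = ‖x‖_s + ‖ẋ‖_s`. -/
instance (T : ℝ) [Fact (0 < T)] (n : ℕ) (s : ℝ≥0∞) [Fact (1 ≤ s)] :
    NormedAddCommGroup (W1 T n s) :=
  NormedAddCommGroup.induced _ _ (W1.toPair T n s) (W1.toPair_injective T n s)

instance (T : ℝ) [Fact (0 < T)] (n : ℕ) (s : ℝ≥0∞) [Fact (1 ≤ s)] : NormedSpace ℝ (W1 T n s) :=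
  NormedSpace.induced ℝ (W1 T n s) _ (W1.toPair T n s)

theorem W1.norm_eq {T : ℝ} [Fact (0 < T)] {n : ℕ} {s : ℝ≥0∞} [Fact (1 ≤ s)] (x : W1 T n s) :
    ‖x‖ = (eLpNorm x.val s (mu T)).toReal + (eLpNorm x.dot s (mu T)).toReal := by
  rw [← Lp.norm_toLp _ x.memLp_val, ← Lp.norm_toLp _ x.memLp_dot]
  exact WithLp.prod_norm_eq_of_L1 (W1.toPair T n s x)

/-- The inclusion `W^{1,∞} ⊆ W^{1,r}` (the same function). -/
def W1.incl (r : ℝ≥0∞) {T : ℝ} {n : ℕ} (x : W1 T n ∞) : W1 T n r :=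
  ⟨x.1, x.2.1, x.2.2.mono_exponent le_top⟩

/-- The inclusion `L^∞ ⊆ L¹` on `[0, T]`. -/
def toL1 {T : ℝ} {m : ℕ} (u : Lp (Euc m) ∞ (mu T)) : Lp (Euc m) 1 (mu T) :=
  AddSubgroup.inclusion (Lp.antitone le_top) u

/-- The space `X = W^{1,∞}([0,T]; ℝⁿ) × L^∞([0,T]; ℝᵐ)`. -/
abbrev XSpace (T : ℝ) (n m : ℕ) := W1 T n ∞ × Lp (Euc m) ∞ (mu T)

/-- The inclusion of `X` into `Y = W^{1,1}([0,T]; ℝⁿ) × L¹([0,T]; ℝᵐ)`. -/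
def toY {T : ℝ} {n m : ℕ} (p : XSpace T n m) : W1 T n 1 × Lp (Euc m) 1 (mu T) :=
  (p.1.incl 1, toL1 p.2)

/-! ### Convex analysis and measurability -/

/-- State-control pairs `(x, u) ∈ ℝⁿ × ℝᵐ`, as a Euclidean space. -/
abbrev Z (n m : ℕ) := WithLp 2 (Euc n × Euc m)

/-- Pairs of end-points `(x(0), x(T)) ∈ ℝ²ⁿ`, as a Euclidean space. -/
abbrev B (n : ℕ) := WithLp 2 (Euc n × Euc n)

/-- The subdifferential of `f` at `a` in the sense of convex analysis. -/
def subdiff {E : Type*} [NormedAddCommGroup E] [InnerProductSpace ℝ E] (f : E → ℝ) (a : E) :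
    Set E :=
  {v | ∀ y, f a + ⟪v, y - a⟫_ℝ ≤ f y}

/-- Carathéodory functions on `(ℝⁿ × ℝᵐ) × [0, T]`. -/
def IsCaratheodory (T : ℝ) {n m : ℕ} (f : Z n m → ℝ → ℝ) : Prop :=
  (∀ᵐ t ∂(mu T), Continuous fun z => f z t) ∧ ∀ z, AEStronglyMeasurable (f z) (mu T)

/-- Lebesgue measurability of a set-valued map on `[0, T]`. -/
def MeasurableMultifunction (T : ℝ) {E : Type*} [TopologicalSpace E] (S : ℝ → Set E) : Prop :=
  ∀ O : Set E, IsOpen O → NullMeasurableSet {t | (S t ∩ O).Nonempty} (mu T)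

/-- The curve `t ↦ (x(t), u(t))`. -/
def zval {T : ℝ} {n m : ℕ} (p : XSpace T n m) (t : ℝ) : Z n m := WithLp.toLp 2 (p.1.val t, p.2 t)

/-- The end-points `(x(0), x(T))`. -/
def bval {T : ℝ} {n m : ℕ} (p : XSpace T n m) : B n := WithLp.toLp 2 (p.1.val 0, p.1.val T)

/-- `‖(x, u)‖₂²`. -/
def l2sq {T : ℝ} {n m : ℕ} (p : XSpace T n m) : ℝ := ∫ t, ‖zval p t‖ ^ 2 ∂(mu T)

/-! ### The optimal control problem -/

/-- The data of the optimal control problem: the set `X₀`, and the DC decompositions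
`F₀ = G₀ - H₀`, `F = G - H`, `Ξ_s = p_s - q_s`, `f_i = g_i - h_i`, where the objective's end-point
function has index `0`, the inequality constraints are indexed by `Fin ℓI` and the equality
constraints by `Fin ℓE`. -/
structure DCProblem (T : ℝ) (n m ℓI ℓE ℓM : ℕ) where
  X₀ : Set (XSpace T n m)
  G₀ : Z n m → ℝ → ℝ
  H₀ : Z n m → ℝ → ℝ
  G : Fin n → Z n m → ℝ → ℝ
  H : Fin n → Z n m → ℝ → ℝ
  p : Fin ℓM → Z n m → ℝ → ℝ
  q : Fin ℓM → Z n m → ℝ → ℝ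
  g₀ : B n → ℝ
  h₀ : B n → ℝ
  gI : Fin ℓI → B n → ℝ
  hI : Fin ℓI → B n → ℝ
  gE : Fin ℓE → B n → ℝ
  hE : Fin ℓE → B n → ℝ

namespace DCProblem

variable {T : ℝ} {n m ℓI ℓE ℓM : ℕ} (P : DCProblem T n m ℓI ℓE ℓM)

def F₀ (z : Z n m) (t : ℝ) : ℝ := P.G₀ z t - P.H₀ z t

def F (i : Fin n) (z : Z n m) (t : ℝ) : ℝ := P.G i z t - P.H i z t

def Ξ (s : Fin ℓM) (z : Z n m) (t : ℝ) : ℝ := P.p s z t - P.q s z t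

def f₀ (b : B n) : ℝ := P.g₀ b - P.h₀ b

def fI (i : Fin ℓI) (b : B n) : ℝ := P.gI i b - P.hI i b

def fE (j : Fin ℓE) (b : B n) : ℝ := P.gE j b - P.hE j b

/-- The standing assumptions on the problem data. -/
structure StandingAssumptions [Fact (0 < T)] : Prop where
  convex_X₀ : Convex ℝ P.X₀
  /-- `X₀ ⊆ X` is closed in the topology of `W^{1,1} × L¹`. -/
  closed_X₀ : IsClosed[TopologicalSpace.induced toY inferInstance] P.X₀
  convex_G₀ : ∀ t ∈ Icc 0 T, ConvexOn ℝ univ fun z => P.G₀ z t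
  convex_H₀ : ∀ t ∈ Icc 0 T, ConvexOn ℝ univ fun z => P.H₀ z t
  convex_G : ∀ i, ∀ t ∈ Icc 0 T, ConvexOn ℝ univ fun z => P.G i z t
  convex_H : ∀ i, ∀ t ∈ Icc 0 T, ConvexOn ℝ univ fun z => P.H i z t
  convex_p : ∀ s, ∀ t ∈ Icc 0 T, ConvexOn ℝ univ fun z => P.p s z t
  convex_q : ∀ s, ∀ t ∈ Icc 0 T, ConvexOn ℝ univ fun z => P.q s z t
  convex_g₀ : ConvexOn ℝ univ P.g₀
  convex_h₀ : ConvexOn ℝ univ P.h₀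
  convex_gI : ∀ i, ConvexOn ℝ univ (P.gI i)
  convex_hI : ∀ i, ConvexOn ℝ univ (P.hI i)
  convex_gE : ∀ j, ConvexOn ℝ univ (P.gE j)
  convex_hE : ∀ j, ConvexOn ℝ univ (P.hE j)
  car_G₀ : IsCaratheodory T P.G₀
  car_H₀ : IsCaratheodory T P.H₀
  car_G : ∀ i, IsCaratheodory T (P.G i)
  car_H : ∀ i, IsCaratheodory T (P.H i)
  car_p : ∀ s, IsCaratheodory T (P.p s)
  car_q : ∀ s, IsCaratheodory T (P.q s)
  growth : ∀ R > 0, ∃ γ > 0, ∀ᵐ t ∂(mu T), ∀ z : Z n m, ‖z.fst‖ + ‖z.snd‖ ≤ R →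
    |P.G₀ z t| ≤ γ ∧ |P.H₀ z t| ≤ γ ∧
    ‖(WithLp.toLp 2 fun i => P.G i z t : Euc n)‖ ≤ γ ∧
    ‖(WithLp.toLp 2 fun i => P.H i z t : Euc n)‖ ≤ γ ∧
    ∀ s, |P.p s z t| ≤ γ ∧ |P.q s z t| ≤ γ
  meas_subdiff : ∀ a : XSpace T n m,
    MeasurableMultifunction T (fun t => subdiff (fun z => P.G₀ z t) (zval a t)) ∧
    MeasurableMultifunction T (fun t => subdiff (fun z => P.H₀ z t) (zval a t)) ∧
    (∀ i, MeasurableMultifunction T (fun t => subdiff (fun z => P.G i z t) (zval a t))) ∧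
    (∀ i, MeasurableMultifunction T (fun t => subdiff (fun z => P.H i z t) (zval a t))) ∧
    (∀ s, MeasurableMultifunction T (fun t => subdiff (fun z => P.p s z t) (zval a t))) ∧
    (∀ s, MeasurableMultifunction T (fun t => subdiff (fun z => P.q s z t) (zval a t)))
  growth_subdiff : ∀ R > 0, ∃ γ > 0, ∀ᵐ t ∂(mu T), ∀ z : Z n m, ‖z.fst‖ + ‖z.snd‖ ≤ R →
    (∀ v ∈ subdiff (fun y => P.G₀ y t) z ∪ subdiff (fun y => P.H₀ y t) z, ‖v‖ ≤ γ) ∧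
    (∀ i, ∀ v ∈ subdiff (fun y => P.G i y t) z ∪ subdiff (fun y => P.H i y t) z, ‖v‖ ≤ γ) ∧
    (∀ s, ∀ v ∈ subdiff (fun y => P.p s y t) z ∪ subdiff (fun y => P.q s y t) z, ‖v‖ ≤ γ)

/-- Feasible pairs of the problem. -/
structure Feasible (a : XSpace T n m) : Prop where
  mem : a ∈ P.X₀
  dynamics : ∀ᵐ t ∂(mu T), ∀ i, a.1.dot t i = P.F i (zval a t) t
  ineq : ∀ i, P.fI i (bval a) ≤ 0
  eq : ∀ j, P.fE j (bval a) = 0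
  mixed : ∀ s, ∀ᵐ t ∂(mu T), P.Ξ s (zval a t) t ≤ 0

/-- The constraints of the problem (those in `X₀` and the functional ones) fix `x(0)`. -/
def InitialConditionFixed : Prop := ∃ xInit : Euc n, ∀ a, P.Feasible a → a.1.val 0 = xInit

/-- The cost functional `J`. -/
def J (a : XSpace T n m) : ℝ := (∫ t, P.F₀ (zval a t) t ∂(mu T)) + P.f₀ (bval a)

/-- The `L¹` penalty term. -/
def φ (a : XSpace T n m) : ℝ :=
  (∑ i, ∫ t, |a.1.dot t i - P.F i (zval a t) t| ∂(mu T))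
  + (∑ i, max 0 (P.fI i (bval a)))
  + (∑ j, |P.fE j (bval a)|)
  + (∑ s, ∫ t, max 0 (P.Ξ s (zval a t) t) ∂(mu T))

/-- The penalty function `Φ_c = J + c φ`. -/
def Φ (c : ℝ) (a : XSpace T n m) : ℝ := P.J a + c * P.φ a

/-! ### The algorithmic pattern -/

/-- The components of a collection of subgradients. -/
structure Subgradients (n m ℓI ℓE ℓM : ℕ) where
  V₀ : ℝ → Z n m
  V : Fin n → ℝ → Z n m
  W : Fin n → ℝ → Z n m
  v₀ : B n
  vI : Fin ℓI → B n
  vE : Fin ℓE → B n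
  wE : Fin ℓE → B n
  z : Fin ℓM → ℝ → Z n m

/-- `V` is a collection of (measurable) subgradients at the pair `a`. -/
structure IsSubgradients (a : XSpace T n m) (V : Subgradients n m ℓI ℓE ℓM) : Prop where
  meas_V₀ : AEStronglyMeasurable V.V₀ (mu T)
  meas_V : ∀ i, AEStronglyMeasurable (V.V i) (mu T)
  meas_W : ∀ i, AEStronglyMeasurable (V.W i) (mu T)
  meas_z : ∀ s, AEStronglyMeasurable (V.z s) (mu T)
  mem_V₀ : ∀ᵐ t ∂(mu T), V.V₀ t ∈ subdiff (fun y => P.H₀ y t) (zval a t)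
  mem_V : ∀ i, ∀ᵐ t ∂(mu T), V.V i t ∈ subdiff (fun y => P.H i y t) (zval a t)
  mem_W : ∀ i, ∀ᵐ t ∂(mu T), V.W i t ∈ subdiff (fun y => P.G i y t) (zval a t)
  mem_z : ∀ s, ∀ᵐ t ∂(mu T), V.z s t ∈ subdiff (fun y => P.q s y t) (zval a t)
  mem_v₀ : V.v₀ ∈ subdiff P.h₀ (bval a)
  mem_vI : ∀ i, V.vI i ∈ subdiff (P.hI i) (bval a)
  mem_vE : ∀ j, V.vE j ∈ subdiff (P.hE j) (bval a)
  mem_wE : ∀ j, V.wE j ∈ subdiff (P.gE j) (bval a)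

/-- The convex majorant `Γ(a; b; V)` of the penalty term, constructed at `b`. -/
def Γ (a b : XSpace T n m) (V : Subgradients n m ℓI ℓE ℓM) : ℝ :=
  (∑ i, ∫ t, max
      (a.1.dot t i + P.H i (zval a t) t - P.G i (zval b t) t - ⟪V.W i t, zval a t - zval b t⟫_ℝ)
      (-a.1.dot t i + P.G i (zval a t) t - P.H i (zval b t) t - ⟪V.V i t, zval a t - zval b t⟫_ℝ)
      ∂(mu T))
  + (∑ i, max 0 (P.gI i (bval a) - P.hI i (bval b) - ⟪V.vI i, bval a - bval b⟫_ℝ))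
  + (∑ j, max (P.gE j (bval a) - P.hE j (bval b) - ⟪V.vE j, bval a - bval b⟫_ℝ)
      (P.hE j (bval a) - P.gE j (bval b) - ⟪V.wE j, bval a - bval b⟫_ℝ))
  + (∑ s, ∫ t, max 0
      (P.p s (zval a t) t - P.q s (zval b t) t - ⟪V.z s t, zval a t - zval b t⟫_ℝ) ∂(mu T))

/-- The convex function `Q_c(a; b; V)` of the penalised subproblem, constructed at `b`. -/
def Q (c : ℝ) (a b : XSpace T n m) (V : Subgradients n m ℓI ℓE ℓM) : ℝ :=
  (∫ t, (P.G₀ (zval a t) t - ⟪V.V₀ t, zval a t⟫_ℝ) ∂(mu T))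
  + P.g₀ (bval a) - ⟪V.v₀, bval a⟫_ℝ + c * P.Γ a b V

/-- `a` is an `ε`-optimal solution of the problem of minimising `f` over `S`. -/
def EpsOptimal {α : Type*} (f : α → ℝ) (S : Set α) (ε : ℝ) (a : α) : Prop :=
  a ∈ S ∧ ∀ b ∈ S, f a ≤ f b + ε

/-- `WhileLoop ok sol c a c' a'`: starting from the penalty parameter `c` and the point `a`, the
loop "while `ok` fails, increase the parameter and compute a new point satisfying `sol`" ends
with `c'` and `a'`. -/
inductive WhileLoop {α : Type*} (ok sol : ℝ → α → Prop) : ℝ → α → ℝ → α → Prop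
  | done (c : ℝ) (a : α) : ok c a → WhileLoop ok sol c a c a
  | step (c : ℝ) (a : α) (c₁ : ℝ) (a₁ : α) (c' : ℝ) (a' : α) : ¬ ok c a → c < c₁ → sol c₁ a₁ →
      WhileLoop ok sol c₁ a₁ c' a' → WhileLoop ok sol c a c' a'

/-- The parameters of the method. -/
structure Parameters where
  η₁ : ℝ
  η₂ : ℝ
  ζ : ℝ
  σ : ℝ
  εφ : ℝ
  εfeas : ℝ
  ε : ℕ → ℝ
  η₁_mem : η₁ ∈ Ioo 0 1
  η₂_mem : η₂ ∈ Ioo 0 1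
  ζ_mem : ζ ∈ Ioo 0 1
  σ_mem : σ ∈ Ioo 0 1
  εφ_pos : 0 < εφ
  εfeas_pos : 0 < εfeas
  ε_pos : ∀ k, 0 < ε k

/-- Steps 1-3: from the iterate `a`, the subgradients `V` and the penalty parameter `c`, the method
arrives at Step 4 with the parameter `cp` and the point `ap`. -/
def Steps123 (π : Parameters) (ε : ℝ) (a : XSpace T n m) (V : Subgradients n m ℓI ℓE ℓM)
    (c cp : ℝ) (ap : XSpace T n m) : Prop :=
  ∃ a₁, EpsOptimal (fun b => P.Q c b a V) P.X₀ ε a₁ ∧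
    ((P.Γ a₁ a V ≤ π.εφ ∧ cp = c ∧ ap = a₁) ∨
     (¬ P.Γ a₁ a V ≤ π.εφ ∧ ∃ â, EpsOptimal (fun b => P.Γ b a V) P.X₀ ε â ∧
       ((¬ P.Γ â a V < P.Γ a a V ∧
          WhileLoop (fun _ b => P.Γ b a V ≤ P.Γ a a V + π.εfeas)
            (fun d b => EpsOptimal (fun b' => P.Q d b' a V) P.X₀ ε b) c a₁ cp ap) ∨
        (P.Γ â a V < P.Γ a a V ∧
          WhileLoop (fun _ b => P.Γ b a V - P.Γ a a V ≤ π.η₁ * (P.Γ â a V - P.Γ a a V))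
            (fun d b => EpsOptimal (fun b' => P.Q d b' a V) P.X₀ ε b) c a₁ cp ap))))

/-- Step 4: the penalty parameter is increased until sufficient decay is achieved. -/
def Step4 (π : Parameters) (ε : ℝ) (a : XSpace T n m) (V : Subgradients n m ℓI ℓE ℓM)
    (cp : ℝ) (ap : XSpace T n m) (c' : ℝ) (a' : XSpace T n m) : Prop :=
  WhileLoop
    (fun d b => P.Q d b a V - P.Q d a a V ≤ d * π.η₂ * (P.Γ b a V - P.Γ a a V))
    (fun d b => EpsOptimal (fun b' => P.Q d b' a V) P.X₀ ε b) cp ap c' a'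

/-- Step 5: nonmonotone line search from `a'` in the direction `a' - a`, with a trial step size
`α` for which the trial points belong to `X₀`; the next iterate is `anext`. -/
def Step5 (π : Parameters) (c' : ℝ) (a a' anext : XSpace T n m) : Prop :=
  ∃ ν α : ℝ, 0 < ν ∧ 0 ≤ α ∧
    (∀ j : ℕ, a' + (π.ζ ^ j * α) • (a' - a) ∈ P.X₀) ∧
    ∃ j : ℕ, IsLeast {j : ℕ | P.Φ c' (a' + (π.ζ ^ j * α) • (a' - a)) - P.Φ c' a'
        ≤ -π.σ * (π.ζ ^ j * α) ^ 2 * l2sq (a' - a) + ν} j ∧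
      anext = a' + (π.ζ ^ j * α) • (a' - a)

/-- The (infinite) sequence `a` of pairs is generated by the boosted steering exact penalty DCA. -/
def IsGenerated (a : ℕ → XSpace T n m) : Prop :=
  ∃ (π : Parameters) (c : ℕ → ℝ), 0 < c 0 ∧ a 0 ∈ P.X₀ ∧
    ∀ k, ∃ V, P.IsSubgradients (a k) V ∧ ∃ cp ap a',
      P.Steps123 π (π.ε k) (a k) V (c k) cp ap ∧
      P.Step4 π (π.ε k) (a k) V cp ap (c (k + 1)) a' ∧
      P.Step5 π (c (k + 1)) (a k) a' (a (k + 1))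

end DCProblem

end StepDCA

end

noncomputable section

namespace StepDCA

/-! ### Absolutely continuous functions with values in a Banach space -/

section AbsolutelyContinuous

variable {E : Type*} [NormedAddCommGroup E] [NormedSpace ℝ E]

/-! Everything rests on one stability estimate. On bounded sets `F` and `Ξ` are bounded and
Lipschitz in `(x, u)`, uniformly in `t`, because they are differences of convex functions that are
bounded on a larger ball (`StandingAssumptions.exists_lipschitz`). Grönwall's inequality
(`W1.norm_sub_le_of_norm_dot_sub_le`) then bounds the `W^{1,1}` distance of two approximate
trajectories by a constant times the sum of the distance of their initial values, the `L¹` residuals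
of the dynamics, and the `L¹` distance of the controls (`exists_norm_sub_le`).

Along the subsequence the residuals are at most `φ`, which tends to zero, and the controls converge
in `L¹`. Up to vanishing errors the trajectories are thus as close as their initial values, which
form a bounded set in `ℝⁿ`. Hence they are totally bounded, and relatively compact because `W^{1,1}`
is complete (`isCompact_closure_range`). The bound in `W^{1,r}` enters through the `W^{1,1}` bound
that it implies.

A limit point is feasible because the residual, the violation of the mixed constraints and the
end-point functions pass to the limit, and `X₀` is closed; its derivative equals the bounded
function `F`, so it lies in `W^{1,∞}` (`feasible_of_tendsto`).

If the initial value is fixed, two limit points share the control and the initial value and have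
zero residual, so the stability estimate identifies them (`Feasible.eq_of_initial_eq`). A sequence
in a compact set with a single cluster point converges. -/

theorem absolutelyContinuousOnInterval_of_dist_le {X Y : Type*} [PseudoMetricSpace X]
    [PseudoMetricSpace Y] {f : ℝ → X} {g : ℝ → Y} {a b : ℝ}
    (hg : AbsolutelyContinuousOnInterval g a b)
    (h : ∀ s ∈ uIcc a b, ∀ t ∈ uIcc a b, dist (f s) (f t) ≤ dist (g s) (g t)) :
    AbsolutelyContinuousOnInterval f a b := by
  refine squeeze_zero' ?_ ?_ hg
  · filter_upwards with E
    exact Finset.sum_nonneg fun _ _ => dist_nonneg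
  · filter_upwards [mem_inf_of_right (mem_principal_self _)] with E hE
    exact Finset.sum_le_sum fun i hi => h _ (hE.1 i hi).1 _ (hE.1 i hi).2

/-- The increments are dominated by those of the scalar primitive of `‖v‖`. -/
theorem absolutelyContinuousOnInterval_integral {v : ℝ → E} {a b : ℝ}
    (hv : IntervalIntegrable v volume a b) :
    AbsolutelyContinuousOnInterval (fun t => ∫ s in a..t, v s) a b := by
  refine absolutelyContinuousOnInterval_of_dist_le
    (hv.norm.absolutelyContinuousOnInterval_intervalIntegral left_mem_uIcc) fun s hs t ht => ?_
  have h1 : IntervalIntegrable v volume a s := hv.mono_set (uIcc_subset_uIcc left_mem_uIcc hs)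
  have h2 : IntervalIntegrable v volume a t := hv.mono_set (uIcc_subset_uIcc left_mem_uIcc ht)
  rw [dist_eq_norm, dist_eq_norm, intervalIntegral.integral_interval_sub_left h1 h2,
    intervalIntegral.integral_interval_sub_left h1.norm h2.norm, Real.norm_eq_abs]
  exact intervalIntegral.norm_integral_le_abs_integral_norm

/-- The difference of `f` and the primitive of its derivative is absolutely continuous with zero
derivative a.e., hence constant. Differentiability a.e. has to be assumed, as it can fail in a
general Banach space. -/
theorem integral_deriv_eq_sub_of_absolutelyContinuous [CompleteSpace E] {f : ℝ → E} {a b : ℝ}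
    (hf : AbsolutelyContinuousOnInterval f a b)
    (hd : ∀ᵐ t, t ∈ uIcc a b → DifferentiableAt ℝ f t)
    (hi : IntervalIntegrable (deriv f) volume a b) :
    ∫ t in a..b, deriv f t = f b - f a := by
  obtain ⟨C, hC⟩ := (hf.sub (absolutelyContinuousOnInterval_integral
    hi)).const_of_ae_hasDerivAt_zero (by
      filter_upwards [hd, hi.ae_hasDerivAt_integral] with t h1 h2 ht
      simpa using (h1 ht).hasDerivAt.sub (h2 ht a left_mem_uIcc))
  have h1 := hC a left_mem_uIcc
  have h2 := hC b right_mem_uIcc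
  simp only [Pi.sub_apply, intervalIntegral.integral_same, sub_zero] at h1 h2
  rw [h1, ← h2]; abel

end AbsolutelyContinuous

/-! ### Integrals over `[0, T]` and its subintervals -/

theorem intervalIntegrable_of_mem_Icc {E : Type*} [NormedAddCommGroup E] {T : ℝ} {v : ℝ → E}
    (hv : Integrable v (mu T)) {a b : ℝ} (ha : a ∈ Icc 0 T) (hb : b ∈ Icc 0 T) :
    IntervalIntegrable v volume a b := by
  have h : IntegrableOn v (uIcc a b) := hv.mono_measure
    (Measure.restrict_mono (uIcc_subset_Icc ha hb) le_rfl)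
  exact h.intervalIntegrable

theorem abs_intervalIntegral_le_integral {T : ℝ} {v : ℝ → ℝ} (hv : Integrable v (mu T))
    (h0 : ∀ t, 0 ≤ v t) {a b : ℝ} (ha : a ∈ Icc 0 T) (hb : b ∈ Icc 0 T) :
    |∫ t in a..b, v t| ≤ ∫ t, v t ∂(mu T) := by
  rw [← Real.norm_eq_abs, intervalIntegral.norm_intervalIntegral_eq, Real.norm_eq_abs,
    abs_of_nonneg (integral_nonneg h0)]
  exact setIntegral_mono_set hv (ae_of_all _ h0)
    (uIoc_subset_uIcc.trans (uIcc_subset_Icc ha hb)).eventuallyLE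

theorem measureReal_mu {T : ℝ} (hT : 0 ≤ T) : (mu T).real univ = T := by
  simp [mu, measureReal_def, hT]

theorem integral_const_mu {T : ℝ} (hT : 0 ≤ T) (c : ℝ) : ∫ _, c ∂(mu T) = T * c := by
  rw [integral_const, measureReal_mu hT, smul_eq_mul]

theorem integral_norm_nonneg {E : Type*} [NormedAddCommGroup E] {T : ℝ} (v : ℝ → E) :
    0 ≤ ∫ t, ‖v t‖ ∂(mu T) := integral_nonneg fun _ => norm_nonneg _

/-! ### Pointwise bounds, antiderivatives and completeness in `W^{1,1}` -/

namespace W1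

variable {T : ℝ} {n : ℕ} {s : ℝ≥0∞}

theorem val_sub (x y : W1 T n s) : (x - y).val = x.val - y.val := by
  have h : x.val = (x - y).val + y.val := by
    rw [W1.val, W1.val, W1.val, ← ext0_add]
    exact congrArg (fun w : W1 T n s => ext0 w.1) (sub_add_cancel x y).symm
  rw [h, add_sub_cancel_right]

theorem dot_sub (x y : W1 T n s) : (x - y).dot =ᵐ[mu T] x.dot - y.dot := by
  have h1 : (x - y).dot = deriv (x.val - y.val) := by rw [W1.dot, val_sub]
  rw [h1]
  filter_upwards [ae_differentiable x.2.1, ae_differentiable y.2.1] with t h1 h2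
  exact deriv_sub h1 h2

theorem continuousOn_val [hT : Fact (0 < T)] (x : W1 T n s) : ContinuousOn x.val (Icc 0 T) := by
  have h : ContinuousOn (ext0 x.1) (uIcc 0 T) := x.2.1.continuousOn
  rwa [uIcc_of_le hT.out.le] at h

theorem integrable_dot (hs : 1 ≤ s) (x : W1 T n s) : Integrable x.dot (mu T) :=
  x.memLp_dot.integrable hs

theorem integrable_val (hs : 1 ≤ s) (x : W1 T n s) : Integrable x.val (mu T) :=
  x.memLp_val.integrable hs

theorem integral_dot [hT : Fact (0 < T)] (hs : 1 ≤ s) (x : W1 T n s) {a b : ℝ}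
    (ha : a ∈ Icc 0 T) (hb : b ∈ Icc 0 T) : ∫ t in a..b, x.dot t = x.val b - x.val a := by
  have hsub : uIcc a b ⊆ uIcc 0 T := by
    rw [uIcc_of_le hT.out.le]; exact uIcc_subset_Icc ha hb
  refine integral_deriv_eq_sub_of_absolutelyContinuous (x.2.1.mono hsub) ?_
    (intervalIntegrable_of_mem_Icc (x.integrable_dot hs) ha hb)
  have h := ae_differentiable x.2.1
  rw [ae_restrict_iff' measurableSet_Icc] at h
  filter_upwards [h] with t ht h1
  exact ht (uIcc_subset_Icc ha hb h1)

theorem norm_val_sub_le [Fact (0 < T)] (hs : 1 ≤ s) (x : W1 T n s) {a b : ℝ}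
    (ha : a ∈ Icc 0 T) (hb : b ∈ Icc 0 T) :
    ‖x.val b - x.val a‖ ≤ |∫ t in a..b, ‖x.dot t‖| := by
  rw [← x.integral_dot hs ha hb]
  exact intervalIntegral.norm_integral_le_abs_integral_norm

theorem norm_val_le [Fact (0 < T)] (hs : 1 ≤ s) (x : W1 T n s) {a b : ℝ}
    (ha : a ∈ Icc 0 T) (hb : b ∈ Icc 0 T) :
    ‖x.val b‖ ≤ ‖x.val a‖ + ∫ t, ‖x.dot t‖ ∂(mu T) := by
  have h1 := x.norm_val_sub_le hs ha hb
  have h2 := abs_intervalIntegral_le_integral (x.integrable_dot hs).norm (fun _ => norm_nonneg _)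
    ha hb
  have h3 := norm_le_norm_add_norm_sub' (x.val b) (x.val a)
  linarith

theorem norm_eq_integral [Fact (0 < T)] (x : W1 T n 1) :
    ‖x‖ = (∫ t, ‖x.val t‖ ∂(mu T)) + ∫ t, ‖x.dot t‖ ∂(mu T) := by
  rw [W1.norm_eq, eLpNorm_one_eq_lintegral_enorm, eLpNorm_one_eq_lintegral_enorm,
    integral_norm_eq_lintegral_enorm x.memLp_val.1, integral_norm_eq_lintegral_enorm x.memLp_dot.1]

/-- The embedding of `W^{1,1}` into the continuous functions: the bound of `‖x(t)‖` by `‖x(r)‖` plus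
the integral of `‖ẋ‖` is averaged over `r`, whence the factor `T⁻¹`. -/
theorem norm_val_le_norm [hT : Fact (0 < T)] (x : W1 T n 1) {t : ℝ} (ht : t ∈ Icc 0 T) :
    ‖x.val t‖ ≤ (T⁻¹ + 1) * ‖x‖ := by
  have h1 : ∫ _, ‖x.val t‖ ∂(mu T) ≤ ∫ r, (‖x.val r‖ + ∫ t, ‖x.dot t‖ ∂(mu T)) ∂(mu T) := by
    refine setIntegral_mono_on (integrable_const _)
      ((x.integrable_val le_rfl).norm.add (integrable_const _)) measurableSet_Icc fun r hr => ?_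
    exact x.norm_val_le le_rfl hr ht
  rw [integral_add (x.integrable_val le_rfl).norm (integrable_const _),
    integral_const_mu hT.out.le, integral_const_mu hT.out.le] at h1
  have h2 : ‖x.val t‖ ≤ T⁻¹ * (∫ t, ‖x.val t‖ ∂(mu T)) + ∫ t, ‖x.dot t‖ ∂(mu T) := by
    have := mul_le_mul_of_nonneg_left h1 (inv_nonneg.2 hT.out.le)
    rwa [inv_mul_cancel_left₀ hT.out.ne', mul_add, inv_mul_cancel_left₀ hT.out.ne'] at this
  have h3 := norm_eq_integral x
  have h4 := integral_norm_nonneg (T := T) x.val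
  have h5 := integral_norm_nonneg (T := T) x.dot
  have h6 : 0 < T⁻¹ := inv_pos.2 hT.out
  rw [h3]; nlinarith

theorem norm_le_of_initial [hT : Fact (0 < T)] (x : W1 T n 1) :
    ‖x‖ ≤ T * ‖x.val 0‖ + (T + 1) * ∫ t, ‖x.dot t‖ ∂(mu T) := by
  have h1 : ∫ t, ‖x.val t‖ ∂(mu T) ≤ ∫ _, (‖x.val 0‖ + ∫ t, ‖x.dot t‖ ∂(mu T)) ∂(mu T) := by
    refine setIntegral_mono_on (x.integrable_val le_rfl).norm (integrable_const _)
      measurableSet_Icc fun r hr => ?_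
    exact x.norm_val_le le_rfl (left_mem_Icc.2 hT.out.le) hr
  rw [integral_const_mu hT.out.le] at h1
  rw [norm_eq_integral]; linarith

theorem incl_val (x : W1 T n ∞) : (x.incl s).val = x.val := rfl

/-- Every `v ∈ L^s` has an antiderivative in `W^{1,s}` with initial value `c`. -/
theorem exists_antiderivative [hT : Fact (0 < T)] (hs : 1 ≤ s) (c : Euc n) {v : ℝ → Euc n}
    (hv : MemLp v s (mu T)) : ∃ x : W1 T n s, x.val 0 = c ∧ x.dot =ᵐ[mu T] v := by
  have hi : IntervalIntegrable v volume 0 T := intervalIntegrable_of_mem_Icc (hv.integrable hs)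
    (left_mem_Icc.2 hT.out.le) (right_mem_Icc.2 hT.out.le)
  let y : ℝ → Euc n := fun t => c + ∫ r in (0 : ℝ)..t, v r
  let x : Icc (0 : ℝ) T → Euc n := fun t => y t
  have hxy : ∀ t ∈ Icc 0 T, ext0 x t = y t := fun t ht => ext0_apply x ⟨t, ht⟩
  have hac : AbsolutelyContinuousOnInterval (ext0 x) 0 T := by
    refine absolutelyContinuousOnInterval_of_dist_le
      (absolutelyContinuousOnInterval_integral hi) fun a ha b hb => ?_
    rw [uIcc_of_le hT.out.le] at ha hb
    rw [hxy a ha, hxy b hb, dist_add_left]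
  have hd : deriv (ext0 x) =ᵐ[mu T] v := by
    have h := hi.ae_hasDerivAt_integral
    -- The zero extension agrees with `y` on a neighbourhood of `t` only when `t` is interior; the
    -- two end-points form a null set.
    have h0 : ∀ᵐ t ∂(mu T), t ∈ Ioo 0 T := by
      rw [mu, ← restrict_Ioo_eq_restrict_Icc]
      exact ae_restrict_mem measurableSet_Ioo
    filter_upwards [ae_restrict_of_ae h, h0] with t h1 h2
    rw [uIcc_of_le hT.out.le] at h1
    have h3 : HasDerivAt y (v t) t :=
      (h1 (Ioo_subset_Icc_self h2) 0 (left_mem_Icc.2 hT.out.le)).const_add c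
    refine (h3.congr_of_eventuallyEq ?_).deriv
    filter_upwards [Ioo_mem_nhds h2.1 h2.2] with r hr
    exact hxy r (Ioo_subset_Icc_self hr)
  refine ⟨⟨x, hac, hv.ae_eq hd.symm⟩, ?_, hd⟩
  exact (hxy 0 (left_mem_Icc.2 hT.out.le)).trans (by simp [y])

theorem norm_sub_eq_integral [Fact (0 < T)] (x y : W1 T n 1) :
    ‖x - y‖ = (∫ t, ‖x.val t - y.val t‖ ∂(mu T)) + ∫ t, ‖x.dot t - y.dot t‖ ∂(mu T) := by
  rw [norm_eq_integral, val_sub]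
  congr 1
  exact integral_congr_ae ((dot_sub x y).fun_comp norm)

theorem norm_val_sub_val_le [Fact (0 < T)] (x y : W1 T n 1) {t : ℝ} (ht : t ∈ Icc 0 T) :
    ‖x.val t - y.val t‖ ≤ (T⁻¹ + 1) * ‖x - y‖ := by
  simpa [val_sub] using norm_val_le_norm (x - y) ht

/-- The initial value and the derivative are Lipschitz functions of `x` and together control the
norm (`norm_le_of_initial`). The limit is the antiderivative of the `L¹` limit of the derivatives
that starts at the limit of the initial values. -/
instance [hT : Fact (0 < T)] : CompleteSpace (W1 T n 1) := by
  refine Metric.complete_of_cauchySeq_tendsto fun x hx => ?_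
  have hC : 0 ≤ T⁻¹ + 1 := by have := inv_pos.2 hT.out; linarith
  have h0 : (0 : ℝ) ∈ Icc 0 T := left_mem_Icc.2 hT.out.le
  let D : W1 T n 1 → Lp (Euc n) 1 (mu T) := fun y => y.memLp_dot.toLp y.dot
  have hD : LipschitzWith 1 D := by
    refine LipschitzWith.of_dist_le' (K := 1) (fun y z => ?_) |>.weaken (by simp)
    rw [dist_eq_norm, dist_eq_norm, one_mul, ← MemLp.toLp_sub, L1.norm_eq_integral_norm,
      norm_sub_eq_integral]
    refine (integral_congr_ae
      ((MemLp.coeFn_toLp (y.memLp_dot.sub z.memLp_dot)).fun_comp norm)).trans_le ?_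
    have := integral_norm_nonneg (T := T) (y.val - z.val)
    simpa using this
  have hE : LipschitzWith (T⁻¹ + 1).toNNReal (fun y : W1 T n 1 => y.val 0) := by
    refine LipschitzWith.of_dist_le_mul fun y z => ?_
    rw [dist_eq_norm, dist_eq_norm, Real.coe_toNNReal _ hC]
    exact norm_val_sub_val_le y z h0
  obtain ⟨v, hv⟩ := cauchySeq_tendsto_of_complete (hD.uniformContinuous.comp_cauchySeq hx)
  obtain ⟨c, hc⟩ := cauchySeq_tendsto_of_complete (hE.uniformContinuous.comp_cauchySeq hx)
  obtain ⟨y, hy0, hyd⟩ := exists_antiderivative le_rfl c (Lp.memLp v)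
  refine ⟨y, ?_⟩
  rw [tendsto_iff_norm_sub_tendsto_zero] at hv hc ⊢
  have hlim := (hc.const_mul T).add (hv.const_mul (T + 1))
  rw [mul_zero, mul_zero, add_zero] at hlim
  refine squeeze_zero (fun _ => norm_nonneg _) (fun k => ?_) hlim
  refine (norm_le_of_initial _).trans (le_of_eq ?_)
  congr 2
  · simp [val_sub, hy0]
  · rw [L1.norm_eq_integral_norm]
    refine integral_congr_ae ?_
    filter_upwards [dot_sub (x k) y, hyd, Lp.coeFn_sub (D (x k)) v,
      MemLp.coeFn_toLp (x k).memLp_dot] with t h1 h2 h3 h4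
    simp only [Function.comp_apply]
    rw [h1, h3, Pi.sub_apply, Pi.sub_apply, h2, h4]

/-- A bound in `W^{1,r}` is a bound in `W^{1,1}`. -/
theorem exists_norm_incl_one_le [Fact (0 < T)] (r : ℝ≥0∞) [hr : Fact (1 ≤ r)] :
    ∃ K : ℝ, 0 ≤ K ∧ ∀ x : W1 T n ∞, ‖x.incl 1‖ ≤ K * ‖x.incl r‖ := by
  refine ⟨((mu T) univ ^ (1 / (1 : ℝ≥0∞).toReal - 1 / r.toReal)).toReal,
    ENNReal.toReal_nonneg, fun x => ?_⟩
  have key : ∀ f : ℝ → Euc n, MemLp f r (mu T) → (eLpNorm f 1 (mu T)).toReal ≤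
      ((mu T) univ ^ (1 / (1 : ℝ≥0∞).toReal - 1 / r.toReal)).toReal
        * (eLpNorm f r (mu T)).toReal := by
    intro f hf
    have h := eLpNorm_le_eLpNorm_mul_rpow_measure_univ hr.out hf.1
    rw [← ENNReal.toReal_mul, mul_comm]
    refine ENNReal.toReal_mono (ENNReal.mul_ne_top hf.2.ne ?_) h
    refine ENNReal.rpow_ne_top_of_nonneg ?_ (measure_ne_top _ _)
    have : 1 ≤ r := hr.out
    -- For `r = ∞` the conventions `(∞ : ℝ≥0∞).toReal = 0` and `1 / 0 = 0` give the exponent `1`,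
    -- which is the right one.
    rcases eq_or_ne r ∞ with rfl | h
    · simp
    · have := (ENNReal.toReal_le_toReal ENNReal.one_ne_top h).2 this
      rw [sub_nonneg]
      exact one_div_le_one_div_of_le (by simp) this
  rw [W1.norm_eq, W1.norm_eq, mul_add]
  exact add_le_add (key _ (x.incl r).memLp_val) (key _ (x.incl r).memLp_dot)

end W1

/-! ### Superposition operators -/

theorem IsCaratheodory.sub {T : ℝ} {n m : ℕ} {f g : Z n m → ℝ → ℝ} (hf : IsCaratheodory T f)
    (hg : IsCaratheodory T g) : IsCaratheodory T fun z t => f z t - g z t := by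
  refine ⟨?_, fun z => (hf.2 z).sub (hg.2 z)⟩
  filter_upwards [hf.1, hg.1] with t h1 h2 using h1.sub h2

/-- For simple `z` the composition is a finite sum of indicators times measurable functions `f c`.
The general case is an a.e. limit of these, by continuity in the first argument. -/
theorem IsCaratheodory.aestronglyMeasurable_comp {T : ℝ} {n m : ℕ} {f : Z n m → ℝ → ℝ}
    (hf : IsCaratheodory T f) {z : ℝ → Z n m} (hz : AEStronglyMeasurable z (mu T)) :
    AEStronglyMeasurable (fun t => f (z t) t) (mu T) := by
  have hsimple : ∀ φ : SimpleFunc ℝ (Z n m),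
      AEStronglyMeasurable (fun t => f (φ t) t) (mu T) := by
    intro φ
    have h : (fun t => f (φ t) t) =
        fun t => ∑ c ∈ φ.range, (φ ⁻¹' {c}).indicator (f c) t := by
      funext t
      rw [Finset.sum_eq_single (φ t)]
      · simp
      · intro c _ hc
        exact indicator_of_notMem (fun h => hc h.symm) _
      · intro h
        exact absurd (SimpleFunc.mem_range_self φ t) h
    rw [h]
    exact Finset.aestronglyMeasurable_fun_sum _ fun c _ =>
      (hf.2 c).indicator (φ.measurableSet_fiber c)
  refine aestronglyMeasurable_of_tendsto_ae atTop
    (fun k => hsimple (hz.stronglyMeasurable_mk.approx k)) ?_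
  filter_upwards [hz.ae_eq_mk, hf.1] with t h1 h2
  rw [h1]
  exact (h2.tendsto _).comp (hz.stronglyMeasurable_mk.tendsto_approx t)

theorem norm_toLp_prod_le {E F : Type*} [NormedAddCommGroup E] [NormedAddCommGroup F] (a : E)
    (b : F) : ‖(WithLp.toLp 2 (a, b) : WithLp 2 (E × F))‖ ≤ ‖a‖ + ‖b‖ := by
  rw [WithLp.prod_norm_eq_of_L2]
  refine Real.sqrt_le_iff.2 ⟨by positivity, ?_⟩
  change ‖a‖ ^ 2 + ‖b‖ ^ 2 ≤ _
  nlinarith [mul_nonneg (norm_nonneg a) (norm_nonneg b)]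

theorem norm_fst_add_norm_snd_le {E F : Type*} [NormedAddCommGroup E] [NormedAddCommGroup F]
    (z : WithLp 2 (E × F)) : ‖z.fst‖ + ‖z.snd‖ ≤ 2 * ‖z‖ := by
  rw [two_mul]
  exact add_le_add (WithLp.norm_fst_le _ z) (WithLp.norm_snd_le _ z)

/-- A convex function on the whole space that is bounded by `γ` on the ball of radius `R + 2` is
`2γ`-Lipschitz on the ball of radius `R`. -/
theorem abs_sub_le_of_convexOn {E : Type*} [NormedAddCommGroup E] [NormedSpace ℝ E] {f : E → ℝ}
    (hf : ConvexOn ℝ univ f) {γ R : ℝ} (hγ : 0 ≤ γ) (hb : ∀ z, ‖z‖ ≤ R + 2 → |f z| ≤ γ) {z z' : E}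
    (hz : ‖z‖ ≤ R) (hz' : ‖z'‖ ≤ R) : |f z - f z'| ≤ 2 * γ * ‖z - z'‖ := by
  -- A convex function bounded by `γ` on an open ball is `2γ/ε`-Lipschitz at depth `ε` inside it.
  -- With `ε = 1` this leaves the open ball of radius `R + 1`, which contains the closed ball of
  -- radius `R`.
  have h := (hf.subset (subset_univ (Metric.ball 0 (R + 2)))
    (convex_ball _ _)).lipschitzOnWith_of_abs_le one_pos
    (fun a ha => hb a (by rw [dist_zero_right] at ha; exact ha.le))
  have h1 : ∀ w : E, ‖w‖ ≤ R → w ∈ Metric.ball (0 : E) (R + 2 - 1) := fun w hw => by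
    rw [mem_ball_zero_iff]; linarith
  have h2 := h.dist_le_mul z (h1 z hz) z' (h1 z' hz')
  rwa [Real.dist_eq, dist_eq_norm, div_one, Real.coe_toNNReal _ (by positivity)] at h2

theorem norm_euc_le_sum {n : ℕ} (v : Euc n) : ‖v‖ ≤ ∑ i, |v i| := by
  rw [EuclideanSpace.norm_eq]
  refine Real.sqrt_le_iff.2 ⟨Finset.sum_nonneg fun _ _ => abs_nonneg _, ?_⟩
  simpa using Finset.sum_sq_le_sq_sum_of_nonneg (s := Finset.univ) (f := fun i => |v i|)
    fun i _ => abs_nonneg _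

namespace DCProblem

variable {T : ℝ} {n m ℓI ℓE ℓM : ℕ} {P : DCProblem T n m ℓI ℓE ℓM}

/-- On bounded sets the dynamics and the mixed constraints are bounded and Lipschitz in `(x, u)`,
uniformly in `t`. -/
theorem StandingAssumptions.exists_lipschitz [Fact (0 < T)] (hP : P.StandingAssumptions) (R : ℝ) :
    ∃ L : ℝ, 0 ≤ L ∧ ∀ᵐ t ∂(mu T), ∀ z z' : Z n m, ‖z‖ ≤ R → ‖z'‖ ≤ R →
      (∀ i, |P.F i z t| ≤ L ∧ |P.F i z t - P.F i z' t| ≤ L * ‖z - z'‖) ∧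
      (∀ s, |P.Ξ s z t| ≤ L ∧ |P.Ξ s z t - P.Ξ s z' t| ≤ L * ‖z - z'‖) := by
  -- The factor `2` passes from the Euclidean norm of `z` to `‖z.fst‖ + ‖z.snd‖`, the `+ 2` is the
  -- margin of `abs_sub_le_of_convexOn`, and `|R|` keeps the radius positive.
  obtain ⟨γ, hγ, h⟩ := hP.growth (2 * (|R| + 2)) (by positivity)
  refine ⟨2 * γ + 2 * γ, by positivity, ?_⟩
  filter_upwards [h, ae_restrict_mem measurableSet_Icc] with t ht htT z z' hz hz'
  have hR : ∀ w : Z n m, ‖w‖ ≤ |R| + 2 → ‖w.fst‖ + ‖w.snd‖ ≤ 2 * (|R| + 2) := fun w hw =>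
    (norm_fst_add_norm_snd_le w).trans (by linarith)
  replace hz := hz.trans (le_abs_self R)
  replace hz' := hz'.trans (le_abs_self R)
  have hdiff : ∀ {f g : Z n m → ℝ}, ConvexOn ℝ univ f → ConvexOn ℝ univ g →
      (∀ w, ‖w‖ ≤ |R| + 2 → |f w| ≤ γ) → (∀ w, ‖w‖ ≤ |R| + 2 → |g w| ≤ γ) →
      |f z - g z| ≤ 2 * γ + 2 * γ ∧
        |(f z - g z) - (f z' - g z')| ≤ (2 * γ + 2 * γ) * ‖z - z'‖ := by
    intro f g hf hg hfb hgb
    have h1 := abs_sub_le_of_convexOn hf hγ.le hfb hz hz'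
    have h2 := abs_sub_le_of_convexOn hg hγ.le hgb hz hz'
    refine ⟨(abs_sub _ _).trans ?_, ?_⟩
    · linarith [hfb z (by linarith), hgb z (by linarith)]
    · rw [sub_sub_sub_comm, add_mul]
      exact (abs_sub _ _).trans (add_le_add h1 h2)
  refine ⟨fun i => hdiff (hP.convex_G i t htT) (hP.convex_H i t htT) ?_ ?_,
    fun s => hdiff (hP.convex_p s t htT) (hP.convex_q s t htT)
      (fun w hw => ((ht w (hR w hw)).2.2.2.2 s).1) (fun w hw => ((ht w (hR w hw)).2.2.2.2 s).2)⟩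
  · exact fun w hw => (PiLp.norm_apply_le (WithLp.toLp 2 fun i => P.G i w t : Euc n) i).trans
      (ht w (hR w hw)).2.2.1
  · exact fun w hw => (PiLp.norm_apply_le (WithLp.toLp 2 fun i => P.H i w t : Euc n) i).trans
      (ht w (hR w hw)).2.2.2.1

end DCProblem

/-! ### Grönwall's inequality -/

/-- The differential form of Grönwall's inequality is applied to the right-hand side of `h`, whose
derivative `k * a` is at most `k` times that right-hand side. -/
theorem le_mul_exp_of_le_add_integral {T A k : ℝ} {a : ℝ → ℝ} (hT : 0 ≤ T) (hA : 0 ≤ A)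
    (hk : 0 ≤ k) (ha : ContinuousOn a (Icc 0 T)) (ha0 : ∀ t ∈ Icc 0 T, 0 ≤ a t)
    (h : ∀ t ∈ Icc 0 T, a t ≤ A + k * ∫ s in (0 : ℝ)..t, a s) :
    ∀ t ∈ Icc 0 T, a t ≤ A * Real.exp (k * t) := by
  -- Extending `a` by constants beyond `[0, T]` makes the primitive differentiable everywhere,
  -- end-points included.
  wlog hc : Continuous a generalizing a
  · have hext : ∀ t ∈ Icc 0 T, IccExtend hT ((Icc 0 T).domRestrict a) t = a t := fun t ht =>
      IccExtend_of_mem hT _ ht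
    have hcont : Continuous (IccExtend hT ((Icc 0 T).domRestrict a)) :=
      (continuousOn_iff_continuous_domRestrict.1 ha).Icc_extend'
    intro t ht
    rw [← hext t ht]
    refine this hcont.continuousOn (fun s hs => ?_) (fun s hs => ?_) hcont t ht
    · rw [hext s hs]; exact ha0 s hs
    · rw [hext s hs]
      refine (h s hs).trans (le_of_eq ?_)
      congr 2
      refine intervalIntegral.integral_congr fun r hr => (hext r ?_).symm
      exact uIcc_subset_Icc (left_mem_Icc.2 hT) hs hr
  have hint : ∀ t ∈ Icc 0 T, 0 ≤ ∫ s in (0 : ℝ)..t, a s := fun t ht =>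
    intervalIntegral.integral_nonneg ht.1 fun s hs => ha0 s ⟨hs.1, hs.2.trans ht.2⟩
  have hd : ∀ t, HasDerivAt (fun t => A + k * ∫ s in (0 : ℝ)..t, a s) (k * a t) t := fun t =>
    ((hc.integral_hasStrictDerivAt 0 t).hasDerivAt.const_mul k).const_add A
  intro t ht
  have hb := norm_le_gronwallBound_of_norm_deriv_right_le (δ := A) (K := k) (ε := 0)
    (continuousOn_of_forall_continuousAt fun t _ => (hd t).continuousAt)
    (fun t _ => (hd t).hasDerivWithinAt) (by simp [abs_of_nonneg hA]) (fun s hs => by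
      have hs' := Ico_subset_Icc_self hs
      rw [Real.norm_of_nonneg (mul_nonneg hk (ha0 s hs')), add_zero, Real.norm_of_nonneg
        (add_nonneg hA (mul_nonneg hk (hint s hs')))]
      exact mul_le_mul_of_nonneg_left (h s hs') hk) t ht
  rw [gronwallBound_ε0, sub_zero] at hb
  exact (h t ht).trans ((le_abs_self _).trans hb)

/-- Grönwall's inequality in `W^{1,1}`. -/
theorem W1.norm_sub_le_of_norm_dot_sub_le {T : ℝ} [hT : Fact (0 < T)] {n : ℕ} (x y : W1 T n 1)
    {D : ℝ → ℝ} {k : ℝ} (hk : 0 ≤ k) (hD : Integrable D (mu T)) (hD0 : ∀ t, 0 ≤ D t)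
    (h : ∀ᵐ t ∂(mu T), ‖x.dot t - y.dot t‖ ≤ D t + k * ‖x.val t - y.val t‖) :
    ‖x - y‖ ≤ (1 + (1 + k) * (T * Real.exp (k * T))) *
      (‖x.val 0 - y.val 0‖ + ∫ t, D t ∂(mu T)) := by
  have h0 : (0 : ℝ) ∈ Icc 0 T := left_mem_Icc.2 hT.out.le
  have hdot : Integrable (fun t => ‖x.dot t - y.dot t‖) (mu T) :=
    ((x.integrable_dot le_rfl).sub (y.integrable_dot le_rfl)).norm
  have hval : Integrable (fun t => ‖x.val t - y.val t‖) (mu T) :=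
    ((x.integrable_val le_rfl).sub (y.integrable_val le_rfl)).norm
  set A := ‖x.val 0 - y.val 0‖ + ∫ t, D t ∂(mu T) with hAdef
  have hDi : 0 ≤ ∫ t, D t ∂(mu T) := integral_nonneg hD0
  have hA : 0 ≤ A := add_nonneg (norm_nonneg _) hDi
  have hg : ∀ t ∈ Icc 0 T, ‖x.val t - y.val t‖ ≤ A * Real.exp (k * t) := by
    refine le_mul_exp_of_le_add_integral hT.out.le hA hk
      (x.continuousOn_val.sub y.continuousOn_val).norm (fun t _ => norm_nonneg _) fun t ht => ?_
    have hI := @intervalIntegrable_of_mem_Icc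
    have h1 : ‖x.val t - y.val t‖ ≤ ‖x.val 0 - y.val 0‖ +
        ∫ s in (0 : ℝ)..t, ‖x.dot s - y.dot s‖ := by
      have h2 : (x.val t - y.val t) - (x.val 0 - y.val 0) =
          ∫ s in (0 : ℝ)..t, (x.dot s - y.dot s) := by
        rw [intervalIntegral.integral_sub (hI (x.integrable_dot le_rfl) h0 ht)
          (hI (y.integrable_dot le_rfl) h0 ht), x.integral_dot le_rfl h0 ht,
          y.integral_dot le_rfl h0 ht]
        abel
      have h3 := norm_le_norm_add_norm_sub' (x.val t - y.val t) (x.val 0 - y.val 0)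
      rw [h2] at h3
      exact h3.trans (add_le_add_right
        (intervalIntegral.norm_integral_le_integral_norm ht.1) _)
    have h4 : ∫ s in (0 : ℝ)..t, ‖x.dot s - y.dot s‖ ≤
        ∫ s in (0 : ℝ)..t, (D s + k * ‖x.val s - y.val s‖) := by
      refine intervalIntegral.integral_mono_ae_restrict ht.1 (hI hdot h0 ht)
        (hI (hD.add (hval.const_mul k)) h0 ht) ?_
      exact ae_restrict_of_ae_restrict_of_subset (Icc_subset_Icc_right ht.2) h
    rw [intervalIntegral.integral_add (hI hD h0 ht) (hI (hval.const_mul k) h0 ht),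
      intervalIntegral.integral_const_mul] at h4
    have h5 := (le_abs_self _).trans (abs_intervalIntegral_le_integral hD hD0 h0 ht)
    rw [hAdef]; linarith
  have hv : ∫ t, ‖x.val t - y.val t‖ ∂(mu T) ≤ T * (A * Real.exp (k * T)) := by
    rw [← integral_const_mu hT.out.le]
    refine setIntegral_mono_on hval (integrable_const _) measurableSet_Icc fun t ht => ?_
    refine (hg t ht).trans (mul_le_mul_of_nonneg_left ?_ hA)
    exact Real.exp_le_exp.2 (mul_le_mul_of_nonneg_left ht.2 hk)
  have hd : ∫ t, ‖x.dot t - y.dot t‖ ∂(mu T) ≤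
      (∫ t, D t ∂(mu T)) + k * ∫ t, ‖x.val t - y.val t‖ ∂(mu T) := by
    rw [← integral_const_mul, ← integral_add hD (hval.const_mul k)]
    exact integral_mono_ae hdot (hD.add (hval.const_mul k)) h
  -- The norm is at most `∫ D` plus `1 + k` times the integral of `‖x - y‖`; the former is at most
  -- `A`, the latter integral at most `T * A * exp (k * T)`.
  rw [W1.norm_sub_eq_integral]
  have h6 := mul_le_mul_of_nonneg_left hv hk
  have h7 : ∫ t, D t ∂(mu T) ≤ A := le_add_of_nonneg_left (norm_nonneg _)
  linarith

/-! ### State-control curves, and integrability of the constraints along them -/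

variable {T : ℝ} {n m ℓI ℓE ℓM : ℕ}

/-- The curve `t ↦ (x(t), u(t))` for `x ∈ W^{1,1}`. -/
def curve (x : W1 T n 1) (u : Lp (Euc m) ∞ (mu T)) (t : ℝ) : Z n m := WithLp.toLp 2 (x.val t, u t)

theorem aestronglyMeasurable_curve (x : W1 T n 1) (u : Lp (Euc m) ∞ (mu T)) :
    AEStronglyMeasurable (curve x u) (mu T) :=
  (WithLp.prod_continuous_toLp 2 _ _).comp_aestronglyMeasurable
    (x.memLp_val.1.prodMk (Lp.aestronglyMeasurable u))

theorem norm_curve_sub_le (x y : W1 T n 1) (u v : Lp (Euc m) ∞ (mu T)) (t : ℝ) :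
    ‖curve x u t - curve y v t‖ ≤ ‖x.val t - y.val t‖ + ‖u t - v t‖ :=
  norm_toLp_prod_le (x.val t - y.val t) (u t - v t)

theorem ae_norm_le_norm_Linfty (u : Lp (Euc m) ∞ (mu T)) : ∀ᵐ t ∂(mu T), ‖u t‖ ≤ ‖u‖ := by
  filter_upwards [ae_le_eLpNormEssSup (f := u) (μ := mu T)] with t ht
  rw [Lp.norm_def, eLpNorm_exponent_top]
  have h := Lp.eLpNorm_ne_top u
  rw [eLpNorm_exponent_top] at h
  simpa using ENNReal.toReal_mono h ht

theorem integrable_Linfty (u : Lp (Euc m) ∞ (mu T)) : Integrable u (mu T) :=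
  (Lp.memLp u).integrable le_top

theorem norm_toL1_sub (u v : Lp (Euc m) ∞ (mu T)) :
    ‖toL1 u - toL1 v‖ = ∫ t, ‖u t - v t‖ ∂(mu T) := by
  rw [L1.norm_eq_integral_norm]
  exact integral_congr_ae ((Lp.coeFn_sub (toL1 u) (toL1 v)).fun_comp norm)

/-- Turns norm bounds on `x` and `u` into the pointwise bound under which `exists_lipschitz`
applies. -/
theorem ae_norm_curve_le [Fact (0 < T)] {x : W1 T n 1} {u : Lp (Euc m) ∞ (mu T)} {R : ℝ}
    (hR : (T⁻¹ + 1) * ‖x‖ + ‖u‖ ≤ R) : ∀ᵐ t ∂(mu T), ‖curve x u t‖ ≤ R := by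
  filter_upwards [ae_norm_le_norm_Linfty u, ae_restrict_mem measurableSet_Icc] with t h1 h2
  exact (norm_toLp_prod_le _ _).trans ((add_le_add (x.norm_val_le_norm h2) h1).trans hR)

namespace DCProblem

variable {P : DCProblem T n m ℓI ℓE ℓM}

variable (P) in
/-- The `ℓ¹`-norm of the residual `ẋ(t) - F(x(t), u(t), t)` of the dynamics. -/
def defect (x : W1 T n 1) (u : Lp (Euc m) ∞ (mu T)) (t : ℝ) : ℝ :=
  ∑ i, |x.dot t i - P.F i (curve x u t) t|

theorem defect_nonneg (x : W1 T n 1) (u : Lp (Euc m) ∞ (mu T)) (t : ℝ) : 0 ≤ P.defect x u t :=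
  Finset.sum_nonneg fun _ _ => abs_nonneg _

theorem integrable_apply {v : ℝ → Euc n} (hv : Integrable v (mu T)) (i : Fin n) :
    Integrable (fun t => v t i) (mu T) :=
  (EuclideanSpace.proj (𝕜 := ℝ) i).integrable_comp hv

theorem integrable_F [Fact (0 < T)] (hP : P.StandingAssumptions) (x : W1 T n 1)
    (u : Lp (Euc m) ∞ (mu T)) (i : Fin n) :
    Integrable (fun t => P.F i (curve x u t) t) (mu T) := by
  obtain ⟨L, -, hL⟩ := hP.exists_lipschitz ((T⁻¹ + 1) * ‖x‖ + ‖u‖)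
  refine Integrable.of_bound (C := L) (((hP.car_G i).sub (hP.car_H i)).aestronglyMeasurable_comp
    (aestronglyMeasurable_curve x u)) ?_
  filter_upwards [hL, ae_norm_curve_le (x := x) (u := u) le_rfl] with t h1 h2
  exact ((h1 _ _ h2 h2).1 i).1

theorem integrable_Ξ [Fact (0 < T)] (hP : P.StandingAssumptions) (x : W1 T n 1)
    (u : Lp (Euc m) ∞ (mu T)) (s : Fin ℓM) :
    Integrable (fun t => P.Ξ s (curve x u t) t) (mu T) := by
  obtain ⟨L, -, hL⟩ := hP.exists_lipschitz ((T⁻¹ + 1) * ‖x‖ + ‖u‖)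
  refine Integrable.of_bound (C := L) (((hP.car_p s).sub (hP.car_q s)).aestronglyMeasurable_comp
    (aestronglyMeasurable_curve x u)) ?_
  filter_upwards [hL, ae_norm_curve_le (x := x) (u := u) le_rfl] with t h1 h2
  exact ((h1 _ _ h2 h2).2 s).1

theorem integrable_max_Ξ [Fact (0 < T)] (hP : P.StandingAssumptions) (x : W1 T n 1)
    (u : Lp (Euc m) ∞ (mu T)) (s : Fin ℓM) :
    Integrable (fun t => max 0 (P.Ξ s (curve x u t) t)) (mu T) :=
  (integrable_const 0).sup (integrable_Ξ hP x u s)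

theorem integrable_abs_dot_sub_F [Fact (0 < T)] (hP : P.StandingAssumptions) (x : W1 T n 1)
    (u : Lp (Euc m) ∞ (mu T)) (i : Fin n) :
    Integrable (fun t => |x.dot t i - P.F i (curve x u t) t|) (mu T) :=
  ((integrable_apply (x.integrable_dot le_rfl) i).sub (integrable_F hP x u i)).abs

theorem integrable_defect [Fact (0 < T)] (hP : P.StandingAssumptions) (x : W1 T n 1)
    (u : Lp (Euc m) ∞ (mu T)) : Integrable (P.defect x u) (mu T) :=
  integrable_finsetSum _ fun i _ => integrable_abs_dot_sub_F hP x u i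

/-! ### The penalty term bounds the infeasibility of each constraint -/

theorem φ_bounds [Fact (0 < T)] (hP : P.StandingAssumptions) (a : XSpace T n m) :
    (∫ t, P.defect (a.1.incl 1) a.2 t ∂(mu T)) ≤ P.φ a ∧
    (∀ i, P.fI i (bval a) ≤ P.φ a) ∧ (∀ j, |P.fE j (bval a)| ≤ P.φ a) ∧
    (∀ s, ∫ t, max 0 (P.Ξ s (curve (a.1.incl 1) a.2 t) t) ∂(mu T) ≤ P.φ a) := by
  have h1 : (∫ t, P.defect (a.1.incl 1) a.2 t ∂(mu T)) =
      ∑ i, ∫ t, |a.1.dot t i - P.F i (zval a t) t| ∂(mu T) :=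
    integral_finsetSum _ fun i _ => integrable_abs_dot_sub_F hP (a.1.incl 1) a.2 i
  have n1 : 0 ≤ ∫ t, P.defect (a.1.incl 1) a.2 t ∂(mu T) := integral_nonneg (defect_nonneg _ _)
  have t2 : ∀ i, 0 ≤ max 0 (P.fI i (bval a)) := fun i => le_max_left _ _
  have t3 : ∀ j, 0 ≤ |P.fE j (bval a)| := fun j => abs_nonneg _
  have t4 : ∀ s, 0 ≤ ∫ t, max 0 (P.Ξ s (zval a t) t) ∂(mu T) :=
    fun s => integral_nonneg fun t => le_max_left _ _
  have n2 := Finset.sum_nonneg fun i (_ : i ∈ Finset.univ) => t2 i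
  have n3 := Finset.sum_nonneg fun i (_ : i ∈ Finset.univ) => t3 i
  have n4 := Finset.sum_nonneg fun i (_ : i ∈ Finset.univ) => t4 i
  have hφ : P.φ a = (∫ t, P.defect (a.1.incl 1) a.2 t ∂(mu T)) + (∑ i, max 0 (P.fI i (bval a)))
      + (∑ j, |P.fE j (bval a)|) + (∑ s, ∫ t, max 0 (P.Ξ s (zval a t) t) ∂(mu T)) := by
    rw [h1]; rfl
  rw [hφ]
  refine ⟨by linarith, fun i => ?_, fun j => ?_, fun s => ?_⟩
  · have := Finset.single_le_sum (fun i _ => t2 i) (Finset.mem_univ i)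
    linarith [le_max_right 0 (P.fI i (bval a))]
  · have := Finset.single_le_sum (fun i _ => t3 i) (Finset.mem_univ j)
    linarith
  · have : _ ≤ _ := Finset.single_le_sum (fun i _ => t4 i) (Finset.mem_univ s)
    change ∫ t, max 0 (P.Ξ s (zval a t) t) ∂(mu T) ≤ _
    linarith

/-! ### Stability of approximate trajectories -/

/-- Bounded approximate trajectories depend continuously, in `W^{1,1}`, on the initial value, the
residual, and the control. -/
theorem exists_norm_sub_le [hT : Fact (0 < T)] (hP : P.StandingAssumptions) (R : ℝ) :
    ∃ K : ℝ, 0 ≤ K ∧ ∀ (x y : W1 T n 1) (u v : Lp (Euc m) ∞ (mu T)),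
      (T⁻¹ + 1) * ‖x‖ + ‖u‖ ≤ R → (T⁻¹ + 1) * ‖y‖ + ‖v‖ ≤ R →
      ‖x - y‖ ≤ K * (‖x.val 0 - y.val 0‖ + (∫ t, P.defect x u t ∂(mu T))
        + (∫ t, P.defect y v t ∂(mu T)) + ‖toL1 u - toL1 v‖) := by
  obtain ⟨L, hL0, hL⟩ := hP.exists_lipschitz R
  have hk : 0 ≤ n * L := by positivity
  have hT0 := hT.out.le
  -- The first factor is the Grönwall constant for the rate `n * L`, one `L` for each coordinate of
  -- `F`. The second dominates both the weight `1` of the residuals and the weight `n * L` of the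
  -- controls.
  refine ⟨(1 + (1 + n * L) * (T * Real.exp (n * L * T))) * (1 + n * L), by positivity,
    fun x y u v hxu hyv => ?_⟩
  have huv : Integrable (fun t => ‖u t - v t‖) (mu T) :=
    ((integrable_Linfty u).sub (integrable_Linfty v)).norm
  have hx := integrable_defect hP x u
  have hy := integrable_defect hP y v
  have h := W1.norm_sub_le_of_norm_dot_sub_le x y
    (D := fun t => P.defect x u t + P.defect y v t + n * L * ‖u t - v t‖) hk
    ((hx.add hy).add (huv.const_mul _))
    (fun t => add_nonneg (add_nonneg (defect_nonneg _ _ _) (defect_nonneg _ _ _)) (by positivity))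
    (by
      filter_upwards [hL, ae_norm_curve_le hxu, ae_norm_curve_le hyv] with t h1 h2 h3
      have h4 : ∀ i, |(x.dot t - y.dot t) i| ≤ |x.dot t i - P.F i (curve x u t) t| +
          |y.dot t i - P.F i (curve y v t) t| + L * (‖x.val t - y.val t‖ + ‖u t - v t‖) := by
        intro i
        have h5 := ((h1 _ _ h2 h3).1 i).2.trans
          (mul_le_mul_of_nonneg_left (norm_curve_sub_le x y u v t) hL0)
        have h6 : (x.dot t - y.dot t) i = (x.dot t i - P.F i (curve x u t) t)
            - (y.dot t i - P.F i (curve y v t) t)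
            + (P.F i (curve x u t) t - P.F i (curve y v t) t) := by
          rw [PiLp.sub_apply]; ring
        rw [h6]
        exact (abs_add_le _ _).trans (add_le_add (abs_sub _ _) h5)
      refine (norm_euc_le_sum _).trans ((Finset.sum_le_sum fun i _ => h4 i).trans (le_of_eq ?_))
      rw [Finset.sum_add_distrib, Finset.sum_add_distrib, Finset.sum_const, Finset.card_univ,
        Fintype.card_fin, nsmul_eq_mul, defect, defect]
      ring)
  refine h.trans ?_
  have hxy : Integrable (fun t => P.defect x u t + P.defect y v t) (mu T) := hx.add hy
  rw [integral_add hxy (huv.const_mul _), integral_add hx hy, integral_const_mul,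
    ← norm_toL1_sub]
  have p1 := norm_nonneg (x.val 0 - y.val 0)
  have p2 : 0 ≤ ∫ t, P.defect x u t ∂(mu T) := integral_nonneg (defect_nonneg _ _)
  have p3 : 0 ≤ ∫ t, P.defect y v t ∂(mu T) := integral_nonneg (defect_nonneg _ _)
  have p4 := norm_nonneg (toL1 u - toL1 v)
  have p5 : (0 : ℝ) ≤ 1 + (1 + n * L) * (T * Real.exp (n * L * T)) := by positivity
  rw [mul_assoc _ (1 + n * L)]
  refine mul_le_mul_of_nonneg_left ?_ p5
  nlinarith

/-- The residual of the dynamics is continuous in `W^{1,1} × L¹` on bounded sets. -/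
theorem exists_integral_defect_le [hT : Fact (0 < T)] (hP : P.StandingAssumptions) (R : ℝ) :
    ∃ K : ℝ, ∀ (x y : W1 T n 1) (u v : Lp (Euc m) ∞ (mu T)),
      (T⁻¹ + 1) * ‖x‖ + ‖u‖ ≤ R → (T⁻¹ + 1) * ‖y‖ + ‖v‖ ≤ R →
      ∫ t, P.defect y v t ∂(mu T) ≤
        (∫ t, P.defect x u t ∂(mu T)) + K * (‖x - y‖ + ‖toL1 u - toL1 v‖) := by
  obtain ⟨L, hL0, hL⟩ := hP.exists_lipschitz R
  refine ⟨n * (1 + L), fun x y u v hxu hyv => ?_⟩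
  have huv : Integrable (fun t => ‖u t - v t‖) (mu T) :=
    ((integrable_Linfty u).sub (integrable_Linfty v)).norm
  have hdot : Integrable (fun t => ‖x.dot t - y.dot t‖) (mu T) :=
    ((x.integrable_dot le_rfl).sub (y.integrable_dot le_rfl)).norm
  have hval : Integrable (fun t => ‖x.val t - y.val t‖) (mu T) :=
    ((x.integrable_val le_rfl).sub (y.integrable_val le_rfl)).norm
  have hx := integrable_defect hP x u
  have hvd : Integrable (fun t => ‖x.val t - y.val t‖ + ‖x.dot t - y.dot t‖) (mu T) :=
    hval.add hdot
  have hsum : Integrable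
      (fun t => ‖x.val t - y.val t‖ + ‖x.dot t - y.dot t‖ + ‖u t - v t‖) (mu T) := hvd.add huv
  have h : ∫ t, P.defect y v t ∂(mu T) ≤ ∫ t, (P.defect x u t + n * (1 + L) *
      (‖x.val t - y.val t‖ + ‖x.dot t - y.dot t‖ + ‖u t - v t‖)) ∂(mu T) := by
    refine integral_mono_ae (integrable_defect hP y v) (hx.add (hsum.const_mul _)) ?_
    filter_upwards [hL, ae_norm_curve_le hxu, ae_norm_curve_le hyv] with t h1 h2 h3
    have h4 : ∀ i, |y.dot t i - P.F i (curve y v t) t| ≤ |x.dot t i - P.F i (curve x u t) t| +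
        (1 + L) * (‖x.val t - y.val t‖ + ‖x.dot t - y.dot t‖ + ‖u t - v t‖) := by
      intro i
      have h5 := ((h1 _ _ h2 h3).1 i).2.trans
        (mul_le_mul_of_nonneg_left (norm_curve_sub_le x y u v t) hL0)
      have h6 : y.dot t i - P.F i (curve y v t) t = (x.dot t i - P.F i (curve x u t) t)
          - (x.dot t - y.dot t) i + (P.F i (curve x u t) t - P.F i (curve y v t) t) := by
        rw [PiLp.sub_apply]; ring
      have h7 : |(x.dot t - y.dot t) i| ≤ ‖x.dot t - y.dot t‖ :=
        PiLp.norm_apply_le (x.dot t - y.dot t) i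
      rw [h6]
      refine (abs_add_le _ _).trans ((add_le_add (abs_sub _ _) h5).trans ?_)
      have p1 := norm_nonneg (x.val t - y.val t)
      have p2 := mul_nonneg hL0 (norm_nonneg (x.dot t - y.dot t))
      have p3 := norm_nonneg (u t - v t)
      linarith
    refine (Finset.sum_le_sum fun i _ => h4 i).trans (le_of_eq ?_)
    rw [Finset.sum_add_distrib, Finset.sum_const, Finset.card_univ, Fintype.card_fin,
      nsmul_eq_mul, defect]
    ring
  rwa [integral_add hx (hsum.const_mul _), integral_const_mul, integral_add hvd huv,
    integral_add hval hdot, ← W1.norm_sub_eq_integral, ← norm_toL1_sub] at h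

/-- The violation of the mixed constraints is continuous in `W^{1,1} × L¹` on bounded sets. -/
theorem exists_integral_max_Ξ_le [hT : Fact (0 < T)] (hP : P.StandingAssumptions) (R : ℝ) :
    ∃ K : ℝ, ∀ (x y : W1 T n 1) (u v : Lp (Euc m) ∞ (mu T)),
      (T⁻¹ + 1) * ‖x‖ + ‖u‖ ≤ R → (T⁻¹ + 1) * ‖y‖ + ‖v‖ ≤ R → ∀ s,
      ∫ t, max 0 (P.Ξ s (curve y v t) t) ∂(mu T) ≤
        (∫ t, max 0 (P.Ξ s (curve x u t) t) ∂(mu T)) + K * (‖x - y‖ + ‖toL1 u - toL1 v‖) := by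
  obtain ⟨L, hL0, hL⟩ := hP.exists_lipschitz R
  refine ⟨L, fun x y u v hxu hyv s => ?_⟩
  have huv : Integrable (fun t => ‖u t - v t‖) (mu T) :=
    ((integrable_Linfty u).sub (integrable_Linfty v)).norm
  have hval : Integrable (fun t => ‖x.val t - y.val t‖) (mu T) :=
    ((x.integrable_val le_rfl).sub (y.integrable_val le_rfl)).norm
  have hx := integrable_max_Ξ hP x u s
  have hsum : Integrable (fun t => L * (‖x.val t - y.val t‖ + ‖u t - v t‖)) (mu T) :=
    (hval.add huv).const_mul L
  have h : ∫ t, max 0 (P.Ξ s (curve y v t) t) ∂(mu T) ≤ ∫ t, (max 0 (P.Ξ s (curve x u t) t) +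
      L * (‖x.val t - y.val t‖ + ‖u t - v t‖)) ∂(mu T) := by
    refine integral_mono_ae (integrable_max_Ξ hP y v s) (hx.add hsum) ?_
    filter_upwards [hL, ae_norm_curve_le hxu, ae_norm_curve_le hyv] with t h1 h2 h3
    have h5 := ((h1 _ _ h2 h3).2 s).2.trans
      (mul_le_mul_of_nonneg_left (norm_curve_sub_le x y u v t) hL0)
    have h6 := (abs_le.1 h5).1
    refine max_le (add_nonneg (le_max_left _ _) (by positivity)) ?_
    have h7 := le_max_right 0 (P.Ξ s (curve x u t) t)
    linarith
  rw [integral_add hx hsum, integral_const_mul, integral_add hval huv, ← norm_toL1_sub] at h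
  refine h.trans (add_le_add_right (mul_le_mul_of_nonneg_left (add_le_add_left ?_ _) hL0) _)
  rw [W1.norm_sub_eq_integral]
  exact le_add_of_nonneg_right (integral_nonneg fun t => norm_nonneg _)

/-- Every trial point of the line search lies in `X₀`, so the accepted one does. -/
theorem IsGenerated.mem {a : ℕ → XSpace T n m} (h : P.IsGenerated a) (k : ℕ) : a k ∈ P.X₀ := by
  obtain ⟨π, c, -, h0, hstep⟩ := h
  cases k with
  | zero => exact h0
  | succ k =>
    obtain ⟨V, -, cp, ap, a', -, -, ν, α, -, -, hmem, j, -, hj⟩ := hstep k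
    rw [hj]
    exact hmem j

/-! ### Limit points are feasible -/

/-- The residual and the mixed violation of the limit are at most `φ` of the `k`-th pair plus a
multiple of its distance to the limit, hence zero. The end-point constraints pass to the limit
because `W^{1,1}` convergence is uniform. -/
theorem feasible_of_tendsto [hT : Fact (0 < T)] (hP : P.StandingAssumptions)
    {x : ℕ → W1 T n ∞} {u : ℕ → Lp (Euc m) ∞ (mu T)} {y : W1 T n 1} {v : Lp (Euc m) ∞ (mu T)}
    {C C' : ℝ} (hx : ∀ k, ‖(x k).incl 1‖ ≤ C) (hu : ∀ k, ‖u k‖ ≤ C')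
    (hmem : ∀ k, (x k, u k) ∈ P.X₀) (hφ : Tendsto (fun k => P.φ (x k, u k)) atTop (𝓝 0))
    (hxy : Tendsto (fun k => (x k).incl 1) atTop (𝓝 y))
    (huv : Tendsto (fun k => toL1 (u k)) atTop (𝓝 (toL1 v))) :
    ∃ xStar : W1 T n ∞, xStar.incl 1 = y ∧ P.Feasible (xStar, v) := by
  have hT' : 0 ≤ T⁻¹ + 1 := by have := inv_pos.2 hT.out; linarith
  set R := (T⁻¹ + 1) * max C ‖y‖ + max C' ‖v‖ with hR
  have hRx : ∀ k, (T⁻¹ + 1) * ‖(x k).incl 1‖ + ‖u k‖ ≤ R := fun k => add_le_add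
    (mul_le_mul_of_nonneg_left ((hx k).trans (le_max_left _ _)) hT') ((hu k).trans (le_max_left _ _))
  have hRy : (T⁻¹ + 1) * ‖y‖ + ‖v‖ ≤ R := add_le_add
    (mul_le_mul_of_nonneg_left (le_max_right _ _) hT') (le_max_right _ _)
  have hlim : ∀ K : ℝ, Tendsto (fun k => P.φ (x k, u k) +
      K * (‖(x k).incl 1 - y‖ + ‖toL1 (u k) - toL1 v‖)) atTop (𝓝 0) := fun K => by
    simpa using hφ.add (((tendsto_iff_norm_sub_tendsto_zero.1 hxy).add
      (tendsto_iff_norm_sub_tendsto_zero.1 huv)).const_mul K)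
  have hb := fun k => φ_bounds hP (x k, u k)
  have hdef : ∀ᵐ t ∂(mu T), ∀ i, y.dot t i = P.F i (curve y v t) t := by
    obtain ⟨K, hK⟩ := exists_integral_defect_le hP R
    have h0 : ∫ t, P.defect y v t ∂(mu T) = 0 := by
      refine le_antisymm (ge_of_tendsto' (hlim K) fun k => ?_) (integral_nonneg (defect_nonneg _ _))
      exact (hK _ y (u k) v (hRx k) hRy).trans (add_le_add_left (hb k).1 _)
    rw [integral_eq_zero_iff_of_nonneg (defect_nonneg _ _) (integrable_defect hP y v)] at h0
    filter_upwards [h0] with t ht i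
    have h := (Finset.sum_eq_zero_iff_of_nonneg fun _ _ => abs_nonneg _).1 ht i (Finset.mem_univ i)
    exact sub_eq_zero.1 (abs_eq_zero.1 h)
  have hmemLp : MemLp y.dot ∞ (mu T) := by
    obtain ⟨L, hL0, hL⟩ := hP.exists_lipschitz R
    refine memLp_top_of_bound y.memLp_dot.1 (n * L) ?_
    filter_upwards [hdef, hL, ae_norm_curve_le hRy] with t h1 h2 h3
    refine (norm_euc_le_sum _).trans ((Finset.sum_le_card_nsmul _ _ L fun i _ => ?_).trans ?_)
    · rw [h1 i]; exact ((h2 _ _ h3 h3).1 i).1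
    · simp
  have hval : ∀ t ∈ Icc 0 T, Tendsto (fun k => (x k).val t) atTop (𝓝 (y.val t)) := fun t ht => by
    rw [tendsto_iff_norm_sub_tendsto_zero]
    have h := (tendsto_iff_norm_sub_tendsto_zero.1 hxy).const_mul (T⁻¹ + 1)
    rw [mul_zero] at h
    exact squeeze_zero (fun _ => norm_nonneg _)
      (fun k => W1.norm_val_sub_val_le ((x k).incl 1) y ht) h
  -- The same function as `y`, now with its derivative known to be essentially bounded; its
  -- inclusion is therefore `y` definitionally.
  let z : W1 T n ∞ := ⟨y.1, y.2.1, hmemLp⟩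
  have hbval : Tendsto (fun k => bval ((x k, u k) : XSpace T n m)) atTop
      (𝓝 (bval ((z, v) : XSpace T n m))) :=
    ((WithLp.prod_continuous_toLp 2 _ _).tendsto _).comp
      ((hval 0 (left_mem_Icc.2 hT.out.le)).prodMk_nhds (hval T (right_mem_Icc.2 hT.out.le)))
  refine ⟨z, rfl, ?_, hdef, fun i => ?_, fun j => ?_, fun s => ?_⟩
  · obtain ⟨S, hS, hS'⟩ := isClosed_induced_iff.1 hP.closed_X₀
    rw [← hS']
    refine hS.mem_of_tendsto (hxy.prodMk_nhds huv) (Eventually.of_forall fun k => ?_)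
    have h := hmem k
    rwa [← hS'] at h
  · have hc : Continuous (P.fI i) :=
      (hP.convex_gI i).locallyLipschitz.continuous.sub (hP.convex_hI i).locallyLipschitz.continuous
    exact le_of_tendsto_of_tendsto' ((hc.tendsto _).comp hbval) hφ fun k => (hb k).2.1 i
  · have hc : Continuous (P.fE j) :=
      (hP.convex_gE j).locallyLipschitz.continuous.sub (hP.convex_hE j).locallyLipschitz.continuous
    have h := le_of_tendsto_of_tendsto' ((hc.abs.tendsto _).comp hbval) hφ fun k => (hb k).2.2.1 j
    exact abs_nonpos_iff.1 h
  · obtain ⟨K, hK⟩ := exists_integral_max_Ξ_le hP R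
    have h0 : ∫ t, max 0 (P.Ξ s (curve y v t) t) ∂(mu T) = 0 := by
      refine le_antisymm (ge_of_tendsto' (hlim K) fun k => ?_)
        (integral_nonneg fun t => le_max_left _ _)
      exact (hK _ y (u k) v (hRx k) hRy s).trans (add_le_add_left ((hb k).2.2.2 s) _)
    have h1 := (integral_eq_zero_iff_of_nonneg
      (f := fun t => max 0 (P.Ξ s (curve y v t) t)) (fun t => le_max_left _ _)
      (integrable_max_Ξ hP y v s)).1 h0
    filter_upwards [h1] with t ht
    exact (le_max_right 0 _).trans_eq ht

/-! ### Compactness of approximate trajectories -/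

/-- If distances in the range of a sequence are controlled by the distances in a bounded sequence
of a proper space, up to errors that vanish, then the range is totally bounded. -/
theorem totallyBounded_range_of_dist_le {X E : Type*} [PseudoMetricSpace X] [PseudoMetricSpace E]
    [ProperSpace E] {x : ℕ → X} {e : ℕ → E} {δ : ℕ → ℝ} {K : ℝ}
    (he : Bornology.IsBounded (range e)) (hδ : Tendsto δ atTop (𝓝 0)) (hK : 0 ≤ K)
    (h : ∀ k l, dist (x k) (x l) ≤ K * (dist (e k) (e l) + δ k + δ l)) :
    TotallyBounded (range x) := by
  rw [Metric.totallyBounded_iff]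
  intro ε hε
  -- Three errors of size `η` are multiplied by `K`; using `K + 1` covers `K = 0` and makes the
  -- final inequality strict.
  have hη : 0 < ε / (3 * (K + 1)) := by positivity
  set η := ε / (3 * (K + 1)) with hη_def
  obtain ⟨N, hN⟩ := eventually_atTop.1 (hδ.eventually (gt_mem_nhds hη))
  have hb : TotallyBounded (e '' Ici N) :=
    (he.subset (image_subset_range _ _)).isCompact_closure.totallyBounded.subset subset_closure
  -- The centres are taken among the `e l` with `l ≥ N`, so that each corresponds to a point `x l`
  -- and has `δ l < η`. The finitely many indices below `N` serve as their own centres.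
  obtain ⟨s, hsN, hs, hcov⟩ := exists_subset_image_finite_and.1 <|
    (totallyBounded_iff_subset.1 hb) _ (Metric.dist_mem_uniformity hη)
  refine ⟨x '' (s ∪ Iio N), (hs.union (finite_Iio N)).image x, ?_⟩
  rintro _ ⟨k, rfl⟩
  rw [biUnion_image]
  rcases lt_or_ge k N with hk | hk
  · exact mem_iUnion₂.2 ⟨k, Or.inr hk, Metric.mem_ball_self hε⟩
  · obtain ⟨_, ⟨l, hl, rfl⟩, hkl⟩ := mem_iUnion₂.1 (hcov (mem_image_of_mem e hk))
    refine mem_iUnion₂.2 ⟨l, Or.inl hl, ?_⟩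
    have h1 : dist (e k) (e l) < η := hkl
    have h2 := hN k hk
    have h3 := hN l (hsN hl)
    rw [Metric.mem_ball]
    calc dist (x k) (x l) ≤ K * (dist (e k) (e l) + δ k + δ l) := h k l
      _ ≤ K * (3 * η) := mul_le_mul_of_nonneg_left (by linarith) hK
      _ < (K + 1) * (3 * η) := by nlinarith
      _ = ε := by rw [hη_def]; field_simp

/-- The stability estimate has the form required by `totallyBounded_range_of_dist_le`: `e` is the
initial value, and `δ k` is `φ` plus the `L¹` distance of the `k`-th control to the limit control.
-/
theorem isCompact_closure_range [hT : Fact (0 < T)] (hP : P.StandingAssumptions)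
    {x : ℕ → W1 T n ∞} {u : ℕ → Lp (Euc m) ∞ (mu T)} {v : Lp (Euc m) ∞ (mu T)}
    {C C' : ℝ} (hx : ∀ k, ‖(x k).incl 1‖ ≤ C) (hu : ∀ k, ‖u k‖ ≤ C')
    (hφ : Tendsto (fun k => P.φ (x k, u k)) atTop (𝓝 0))
    (huv : Tendsto (fun k => toL1 (u k)) atTop (𝓝 (toL1 v))) :
    IsCompact (closure (range fun k => (x k).incl 1)) := by
  have hT' : 0 ≤ T⁻¹ + 1 := by have := inv_pos.2 hT.out; linarith
  have hR : ∀ k, (T⁻¹ + 1) * ‖(x k).incl 1‖ + ‖u k‖ ≤ (T⁻¹ + 1) * C + C' := fun k => add_le_add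
    (mul_le_mul_of_nonneg_left (hx k) hT') (hu k)
  obtain ⟨K, hK0, hK⟩ := exists_norm_sub_le hP ((T⁻¹ + 1) * C + C')
  refine isCompact_iff_totallyBounded_isComplete.2
    ⟨TotallyBounded.closure ?_, isClosed_closure.isComplete⟩
  have hδ : Tendsto (fun k => P.φ (x k, u k) + ‖toL1 (u k) - toL1 v‖) atTop (𝓝 0) := by
    simpa using hφ.add (tendsto_iff_norm_sub_tendsto_zero.1 huv)
  refine totallyBounded_range_of_dist_le (e := fun k => (x k).val 0) ?_ hδ hK0 fun k l => ?_
  · refine isBounded_iff_forall_norm_le.2 ⟨(T⁻¹ + 1) * C, ?_⟩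
    rintro _ ⟨k, rfl⟩
    exact (((x k).incl 1).norm_val_le_norm (left_mem_Icc.2 hT.out.le)).trans
      (mul_le_mul_of_nonneg_left (hx k) hT')
  · rw [dist_eq_norm, dist_eq_norm]
    refine (hK _ _ (u k) (u l) (hR k) (hR l)).trans (mul_le_mul_of_nonneg_left ?_ hK0)
    have h1 := (φ_bounds hP (x k, u k)).1
    have h2 := (φ_bounds hP (x l, u l)).1
    have h3 := norm_sub_le_norm_sub_add_norm_sub (toL1 (u k)) (toL1 v) (toL1 (u l))
    rw [norm_sub_rev (toL1 v)] at h3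
    simp only [W1.incl_val]
    linarith

/-- Feasible pairs with the same control and the same initial value coincide. -/
theorem Feasible.eq_of_initial_eq [hT : Fact (0 < T)] (hP : P.StandingAssumptions)
    {x y : W1 T n ∞} {u : Lp (Euc m) ∞ (mu T)} (hx : P.Feasible (x, u)) (hy : P.Feasible (y, u))
    (h : x.val 0 = y.val 0) : x.incl 1 = y.incl 1 := by
  have hd : ∀ w : W1 T n ∞, P.Feasible (w, u) → ∫ t, P.defect (w.incl 1) u t ∂(mu T) = 0 := by
    intro w hw
    refine integral_eq_zero_of_ae ?_
    filter_upwards [hw.dynamics] with t ht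
    exact Finset.sum_eq_zero fun i _ => abs_eq_zero.2 (sub_eq_zero.2 (ht i))
  obtain ⟨K, -, hK⟩ := exists_norm_sub_le hP
    (max ((T⁻¹ + 1) * ‖x.incl 1‖ + ‖u‖) ((T⁻¹ + 1) * ‖y.incl 1‖ + ‖u‖))
  have h1 := hK (x.incl 1) (y.incl 1) u u (le_max_left _ _) (le_max_right _ _)
  rw [hd x hx, hd y hy, W1.incl_val, W1.incl_val, h] at h1
  simp only [sub_self, norm_zero, add_zero, mul_zero] at h1
  exact sub_eq_zero.1 (norm_le_zero_iff.1 h1)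

end DCProblem

end StepDCA

end

/-! ### Limit points of the generated sequence -/

theorem mainTheorem6 {T : ℝ} [Fact (0 < T)] {n m ℓI ℓE ℓM : ℕ}
    (P : StepDCA.DCProblem T n m ℓI ℓE ℓM) (hP : P.StandingAssumptions)
    (x : ℕ → StepDCA.W1 T n ∞) (u : ℕ → Lp (StepDCA.Euc m) ∞ (StepDCA.mu T))
    (hgen : P.IsGenerated fun k => (x k, u k))
    (r : ℝ≥0∞) [Fact (1 ≤ r)] (hr : 1 < r)
    (hx : ∃ C : ℝ, ∀ k, ‖(x k).incl r‖ ≤ C)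
    (hφ : Tendsto (fun k => P.φ (x k, u k)) atTop (𝓝 0))
    (κ : ℕ → ℕ) (hκ : StrictMono κ)
    (hu : ∃ C : ℝ, ∀ l, ‖u (κ l)‖ ≤ C)
    (uStar : Lp (StepDCA.Euc m) ∞ (StepDCA.mu T))
    (huStar : Tendsto (fun l => StepDCA.toL1 (u (κ l))) atTop (𝓝 (StepDCA.toL1 uStar))) :
    IsCompact (closure (range fun l => (x (κ l)).incl 1)) ∧
    (∀ y : StepDCA.W1 T n 1, MapClusterPt y atTop (fun l => (x (κ l)).incl 1) →
      ∃ xStar : StepDCA.W1 T n ∞, xStar.incl 1 = y ∧ P.Feasible (xStar, uStar)) ∧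
    (P.InitialConditionFixed →
      ∃ y : StepDCA.W1 T n 1, Tendsto (fun l => (x (κ l)).incl 1) atTop (𝓝 y)) := by
  obtain ⟨C, hC⟩ := hx
  obtain ⟨C', hC'⟩ := hu
  obtain ⟨K, hK0, hK⟩ := StepDCA.W1.exists_norm_incl_one_le (T := T) (n := n) r
  have hx1 : ∀ k, ‖(x k).incl 1‖ ≤ K * C := fun k =>
    (hK (x k)).trans (mul_le_mul_of_nonneg_left (hC k) hK0)
  have hcpt := StepDCA.DCProblem.isCompact_closure_range hP (fun l => hx1 (κ l)) hC'
    (hφ.comp hκ.tendsto_atTop) huStar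
  have hfeas : ∀ y : StepDCA.W1 T n 1, MapClusterPt y atTop (fun l => (x (κ l)).incl 1) →
      ∃ xStar : StepDCA.W1 T n ∞, xStar.incl 1 = y ∧ P.Feasible (xStar, uStar) := by
    intro y hy
    obtain ⟨ψ, hψ, hlim⟩ := hy.tendsto_subseq
    exact StepDCA.DCProblem.feasible_of_tendsto hP (fun l => hx1 (κ (ψ l))) (fun l => hC' (ψ l))
      (fun l => hgen.mem (κ (ψ l))) (hφ.comp (hκ.comp hψ).tendsto_atTop) hlim
      (huStar.comp hψ.tendsto_atTop)
  refine ⟨hcpt, hfeas, fun ⟨x0, hx0⟩ => ?_⟩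
  have hmem : ∀ᶠ l in atTop, (x (κ l)).incl 1 ∈ closure (range fun l => (x (κ l)).incl 1) :=
    Eventually.of_forall fun l => subset_closure (mem_range_self l)
  obtain ⟨y, -, hy⟩ := hcpt.exists_mapClusterPt (tendsto_principal.2 hmem)
  -- Compactness supplies a cluster point `y`; convergence to it follows once every other cluster
  -- point is shown to equal it. Both are feasible with the control `uStar`, so both start at `x0`.
  refine ⟨y, hcpt.tendsto_nhds_of_unique_mapClusterPt hmem fun y' _ hy' => ?_⟩
  obtain ⟨z, rfl, hz⟩ := hfeas y hy
  obtain ⟨z', rfl, hz'⟩ := hfeas y' hy'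
  exact hz'.eq_of_initial_eq hP hz ((hx0 _ hz').trans (hx0 _ hz).symm)
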